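/- Let $\mathbb{T}=\mathbb{R}/2\pi\mathbb{Z}$, let $\oint$ denote integration over $\mathbb{T}$, let $c_*=\frac{\pi}{2\sqrt2}$, and let $\eta_*$ be the $2\pi$-periodic peaked profile given by $$\eta_*(x)=\tfrac1{16}\left(\pi^2-4\pi|x|+2x^2\right),\qquad \eta_*'(x)=-\tfrac14(\pi-|x|)\,\mathrm{sign}(x),\qquad x\in[-\pi,\pi].$$ Let $\Pi_0 f=f-\frac1{2\pi}\oint f\,dx$ be the projection of $L^2(\mathbb{T})$ (complex-valued functions) onto the functions of zero mean, and let $\Pi_0\partial_x^{-1}\Pi_0 f$ be the zero-mean periodic primitive of $\Pi_0 f$. Consider the linear operator $A:\mathcal{D}\subset L^2(\mathbb{T})\to L^2(\mathbb{T})$, $$Af=(c_*^2-2\eta_*)f'-\frac1\pi\oint\eta_*'f\,dx+\frac12\Pi_0\partial_x^{-1}\Pi_0f,\qquad \mathcal{D}=\{f\in L^2(\mathbb{T}):\ (c_*^2-2\eta_*)f'\in L^2(\mathbb{T})\},$$ where $f'$ is the distributional derivative on $\mathbb{T}$ and $(c_*^2-2\eta_*)f'$ is defined by $\langle (c_*^2-2\eta_*)f',\varphi\rangle=-\langle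 f,((c_*^2-2\eta_*)\varphi)'\rangle$ for smooth $2\pi$-periodic $\varphi$. The resolvent set $\rho(A)$ is the set of $\lambda\in\mathbb{C}$ for which $A-\lambda:\mathcal{D}\to L^2(\mathbb{T})$ is bijective with bounded inverse, $\sigma(A)=\mathbb{C}\setminus\rho(A)$ is the spectrum, and $\sigma_p(A)$ is the set of eigenvalues of $A$. Then $$\sigma(A)=\left\{\lambda\in\mathbb{C}:\ -\tfrac{\pi}{4}\le\mathrm{Re}(\lambda)\le\tfrac{\pi}{4}\right\},$$ $$\sigma_p(A)=\left\{\lambda\in\mathbb{C}:\ -\tfrac{\pi}{4}<\mathrm{Re}(\lambda)<\tfrac{\pi}{4}\right\},\qquad \rho(A)=\left\{\lambda\in\mathbb{C}:\ |\mathrm{Re}(\lambda)|>\tfrac{\pi}{4}\right\}.$$ In particular, the peaked wave $\eta_*$, whose linearized evolution is $2c_*\,\partial_t\zeta=A\zeta$, is spectrally unstable: $\sigma(A)$ contains points with $\mathrm{Re}(\lambda)>0$. -/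

import Mathlib

open MeasureTheory Real
open scoped ContDiff

noncomputable section

namespace PeakedWave

/-! ### The circle and its `L²` space -/

instance instFactTwoPiPos : Fact ((0 : ℝ) < 2 * π) := ⟨Real.two_pi_pos⟩

/-- The circle `𝕋 = ℝ / 2πℤ`; its `volume` is Lebesgue measure, of total mass `2π`. -/
abbrev Circ : Type := AddCircle (2 * π)

/-- The complex Hilbert space `L²(𝕋)`. -/
abbrev L2 : Type := Lp ℂ 2 (volume : Measure Circ)

/-- The representative of a point of `𝕋` in `(-π, π]`. -/
def rep (x : Circ) : ℝ := (AddCircle.equivIoc (2 * π) (-π) x : ℝ)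

/-! ### The peaked wave -/

/-- The wave speed `c_* = π / (2 √2)`. -/
def cStar : ℝ := π / (2 * √2)

/-- The peaked profile `η_*`, equal to `(π² - 4π|x| + 2x²) / 16` on `[-π, π]`. -/
def peak (x : Circ) : ℝ := (π ^ 2 - 4 * π * |rep x| + 2 * rep x ^ 2) / 16

/-- The slope `η_*'`, equal to `-(π - |x|) sign(x) / 4` on `[-π, π]`. -/
def peakSlope (x : Circ) : ℝ := -(1 / 4) * (π - |rep x|) * Real.sign (rep x)

/-- The coefficient `c_*² - 2 η_*`, a Lipschitz function on `𝕋` vanishing at the peak. -/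
def speed (x : Circ) : ℝ := cStar ^ 2 - 2 * peak x

/-! ### The differential part -/

/-- `(c_*² - 2 η_*) f' = g` on `𝕋`, where `f'` is the distributional derivative of the periodic
function `f`: for every smooth `2π`-periodic test function `φ`,
`⟨(c_*² - 2 η_*) f', φ⟩ = ⟨f', (c_*² - 2 η_*) φ⟩ = -⟨f, ((c_*² - 2 η_*) φ)'⟩`. The derivative in the
last pairing exists off the peak and is bounded. -/
def IsSpeedDeriv (f g : L2) : Prop :=
  ∀ φ : ℝ → ℂ, ContDiff ℝ ∞ φ → Function.Periodic φ (2 * π) →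
    ∫ x in (-π)..π, g (x : Circ) * φ x =
      -∫ x in (-π)..π, f (x : Circ) * deriv (fun y : ℝ => (speed (y : Circ) : ℂ) * φ y) x

theorem integrable_coe (f : L2) : Integrable f volume :=
  (Lp.memLp f).integrable one_le_two

theorem quasi_coe :
    Measure.QuasiMeasurePreserving ((↑) : ℝ → Circ) (volume.restrict (Set.Ioc (-π) π)) volume := by
  have h := AddCircle.measurePreserving_mk (2 * π) (-π)
  rw [show -π + 2 * π = π by ring] at h
  exact h.quasiMeasurePreserving

theorem intervalIntegrable_coe (f : L2) :
    IntervalIntegrable (fun t : ℝ => f (t : Circ)) volume (-π) π := by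
  have h := AddCircle.measurePreserving_mk (2 * π) (-π)
  rw [show -π + 2 * π = π by ring] at h
  rw [intervalIntegrable_iff_integrableOn_Ioc_of_le (by linarith [pi_pos])]
  exact (h.integrable_comp (integrable_coe f).aestronglyMeasurable).2 (integrable_coe f)

theorem rep_coe {x : ℝ} (hx : x ∈ Set.Ioc (-π) π) : rep (x : Circ) = x :=
  AddCircle.equivIoc_coe_of_mem (by rwa [show -π + 2 * π = π by ring])

theorem rep_mem (x : Circ) : rep x ∈ Set.Ioc (-π) π := by
  have h := (AddCircle.equivIoc (2 * π) (-π) x).2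
  exact ⟨h.1, h.2.trans_eq (by ring)⟩

theorem measurable_rep : Measurable rep :=
  measurable_subtype_coe.comp (AddCircle.measurableEquivIoc (2 * π) (-π)).measurable

theorem speed_coe {x : ℝ} (hx : x ∈ Set.Ioc (-π) π) :
    speed (x : Circ) = |x| * (2 * π - |x|) / 4 := by
  have h2 : (√2 : ℝ) ^ 2 = 2 := Real.sq_sqrt (by norm_num)
  rw [speed, peak, rep_coe hx, cStar, div_pow, mul_pow, h2, ← sq_abs x]
  ring

theorem deriv_speed_mul {φ : ℝ → ℂ} (hφ : ContDiff ℝ ∞ φ) {x : ℝ} (hx : x ∈ Set.Ioo (-π) π)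
    (h0 : x ≠ 0) :
    deriv (fun y : ℝ => (speed (y : Circ) : ℂ) * φ y) x =
      ((Real.sign x * (π - |x|) / 2 : ℝ) : ℂ) * φ x +
        ((|x| * (2 * π - |x|) / 4 : ℝ) : ℂ) * deriv φ x := by
  have hd : HasDerivAt (fun y : ℝ => |y| * (2 * π - |y|) / 4) (Real.sign x * (π - |x|) / 2) x := by
    have ha : HasDerivAt (fun y : ℝ => |y|) (Real.sign x) x := by
      rcases lt_or_gt_of_ne h0 with h | h
      · rw [Real.sign_of_neg h]; exact hasDerivAt_abs_neg h
      · rw [Real.sign_of_pos h]; exact hasDerivAt_abs_pos h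
    have h := (ha.mul (ha.const_sub (2 * π))).div_const 4
    exact h.congr_deriv (by ring)
  have he : (fun y : ℝ => (speed (y : Circ) : ℂ) * φ y) =ᶠ[nhds x]
      fun y : ℝ => ((|y| * (2 * π - |y|) / 4 : ℝ) : ℂ) * φ y := by
    filter_upwards [Ioo_mem_nhds hx.1 hx.2] with y hy
    rw [speed_coe ⟨hy.1, hy.2.le⟩]
  rw [he.deriv_eq]
  exact (hd.ofReal_comp.mul (hφ.differentiable (by simp) x).hasDerivAt).deriv

theorem intervalIntegrable_mul_test (f : L2) {φ : ℝ → ℂ} (hφ : ContDiff ℝ ∞ φ) :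
    IntervalIntegrable (fun x : ℝ => f (x : Circ) * φ x) volume (-π) π :=
  (intervalIntegrable_coe f).mul_continuousOn hφ.continuous.continuousOn

theorem intervalIntegrable_mul_deriv (f : L2) {φ : ℝ → ℂ} (hφ : ContDiff ℝ ∞ φ) :
    IntervalIntegrable (fun x : ℝ => f (x : Circ) *
      deriv (fun y : ℝ => (speed (y : Circ) : ℂ) * φ y) x) volume (-π) π := by
  have hc : Continuous (fun x : ℝ => ((π : ℝ) / 2 : ℝ) * ‖φ x‖ + π ^ 2 / 2 * ‖deriv φ x‖) := by
    have := hφ.continuous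
    have := hφ.continuous_deriv (by simp)
    fun_prop
  have hle : -π ≤ π := by linarith [pi_pos]
  obtain ⟨C, hC⟩ := (isCompact_Icc (a := -π) (b := π)).bddAbove_image hc.continuousOn
  have hf := intervalIntegrable_coe f
  rw [intervalIntegrable_iff_integrableOn_Ioc_of_le hle] at hf ⊢
  refine hf.mul_bdd (c := C) (measurable_deriv _).aestronglyMeasurable ?_
  have h0 : ∀ᵐ x : ℝ ∂(volume.restrict (Set.Ioc (-π) π)), x ≠ 0 ∧ x ≠ π :=
    ae_restrict_of_ae ((Measure.ae_ne volume 0).and (Measure.ae_ne volume π))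
  filter_upwards [h0, ae_restrict_mem measurableSet_Ioc] with x hx hm
  rw [deriv_speed_mul hφ ⟨hm.1, lt_of_le_of_ne hm.2 hx.2⟩ hx.1]
  refine le_trans ?_ (hC (Set.mem_image_of_mem _ ⟨hm.1.le, hm.2⟩))
  have hax : |x| ≤ π := abs_le.2 ⟨hm.1.le, hm.2⟩
  have hax0 := abs_nonneg x
  have hs : |Real.sign x| ≤ 1 := by
    rcases Real.sign_apply_eq x with h | h | h <;> simp [h]
  refine (norm_add_le _ _).trans ?_
  rw [norm_mul, norm_mul, Complex.norm_real, Complex.norm_real, Real.norm_eq_abs, Real.norm_eq_abs]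
  gcongr
  · rw [abs_div, abs_mul, abs_of_nonneg (by linarith : 0 ≤ π - |x|), abs_two]
    have : |Real.sign x| * (π - |x|) ≤ 1 * π := by gcongr; linarith
    linarith
  · rw [abs_of_nonneg (by nlinarith [pi_pos])]
    nlinarith [pi_pos]

theorem contDiff_fourier (n : ℤ) : ContDiff ℝ ∞ (fun x : ℝ => (fourier n (x : Circ) : ℂ)) := by
  simp only [fourier_coe_apply]
  have : ContDiff ℝ ∞ (fun x : ℝ => (x : ℂ)) := Complex.ofRealCLM.contDiff
  fun_prop

theorem IsSpeedDeriv.add {f₁ f₂ g₁ g₂ : L2} (h₁ : IsSpeedDeriv f₁ g₁) (h₂ : IsSpeedDeriv f₂ g₂) :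
    IsSpeedDeriv (f₁ + f₂) (g₁ + g₂) := by
  intro φ hφ hp
  have key : ∀ (u v : L2) (w : ℝ → ℂ),
      IntervalIntegrable (fun x : ℝ => u (x : Circ) * w x) volume (-π) π →
      IntervalIntegrable (fun x : ℝ => v (x : Circ) * w x) volume (-π) π →
      ∫ x in (-π)..π, (u + v : L2) (x : Circ) * w x =
        (∫ x in (-π)..π, u (x : Circ) * w x) + ∫ x in (-π)..π, v (x : Circ) * w x := by
    intro u v w hu hv
    rw [← intervalIntegral.integral_add hu hv]
    refine intervalIntegral.integral_congr_ae_restrict ?_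
    rw [Set.uIoc_of_le (by linarith [pi_pos])]
    filter_upwards [quasi_coe.ae (Lp.coeFn_add u v)] with x hx
    rw [hx, Pi.add_apply, add_mul]
  rw [key _ _ _ (intervalIntegrable_mul_test _ hφ) (intervalIntegrable_mul_test _ hφ),
    key _ _ _ (intervalIntegrable_mul_deriv _ hφ) (intervalIntegrable_mul_deriv _ hφ),
    h₁ φ hφ hp, h₂ φ hφ hp]
  ring

theorem IsSpeedDeriv.smul {f g : L2} (a : ℂ) (h : IsSpeedDeriv f g) :
    IsSpeedDeriv (a • f) (a • g) := by
  intro φ hφ hp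
  have key : ∀ (u : L2) (w : ℝ → ℂ), ∫ x in (-π)..π, (a • u : L2) (x : Circ) * w x =
      a * ∫ x in (-π)..π, u (x : Circ) * w x := by
    intro u w
    rw [← intervalIntegral.integral_const_mul]
    refine intervalIntegral.integral_congr_ae_restrict ?_
    rw [Set.uIoc_of_le (by linarith [pi_pos])]
    filter_upwards [quasi_coe.ae (Lp.coeFn_smul a u)] with x hx
    rw [hx, Pi.smul_apply, smul_eq_mul, mul_assoc]
  rw [key, key, h φ hφ hp, mul_neg]

theorem isSpeedDeriv_zero : IsSpeedDeriv 0 0 := by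
  intro φ _ _
  have key : ∀ w : ℝ → ℂ, ∫ x in (-π)..π, (0 : L2) (x : Circ) * w x = 0 := by
    intro w
    rw [← intervalIntegral.integral_zero (a := -π) (b := π) (μ := volume) (E := ℂ)]
    refine intervalIntegral.integral_congr_ae_restrict ?_
    rw [Set.uIoc_of_le (by linarith [pi_pos])]
    filter_upwards [quasi_coe.ae (Lp.coeFn_zero ℂ 2 (volume : Measure Circ))] with x hx
    rw [hx, Pi.zero_apply, zero_mul]
  rw [key, key, neg_zero]

/-- The function `(c_*² - 2 η_*) f'` is unique. -/
theorem IsSpeedDeriv.unique {f g₁ g₂ : L2} (h₁ : IsSpeedDeriv f g₁) (h₂ : IsSpeedDeriv f g₂) :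
    g₁ = g₂ := by
  have hL : MemLp (fun x => g₁ x - g₂ x) 2 (AddCircle.haarAddCircle (T := 2 * π)) :=
    memLp_haarAddCircle_iff.2 ((Lp.memLp g₁).sub (Lp.memLp g₂))
  have hc : ∀ n : ℤ, fourierCoeff (fun x => g₁ x - g₂ x) n = 0 := by
    intro n
    rw [fourierCoeff_eq_intervalIntegral _ n (-π), show -π + 2 * π = π by ring]
    have e := (h₁ _ (contDiff_fourier (-n)) (fun x => by simp)).trans
      (h₂ _ (contDiff_fourier (-n)) (fun x => by simp)).symm
    have : ∫ x in (-π)..π, fourier (-n) (x : Circ) • (g₁ (x : Circ) - g₂ (x : Circ)) = 0 := by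
      rw [← sub_eq_zero, ← intervalIntegral.integral_sub
        (intervalIntegrable_mul_test _ (contDiff_fourier (-n)))
        (intervalIntegrable_mul_test _ (contDiff_fourier (-n)))] at e
      rw [← e]
      refine intervalIntegral.integral_congr fun x _ => ?_
      simp only [smul_eq_mul]
      ring
    rw [this, smul_zero]
  have hz : hL.toLp _ = 0 := by
    apply fourierBasis.repr.injective
    ext n
    rw [fourierBasis_repr, map_zero, fourierCoeff_congr_ae hL.coeFn_toLp, hc n]
    rfl
  have hae : (fun x => g₁ x - g₂ x) =ᵐ[AddCircle.haarAddCircle (T := 2 * π)] 0 :=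
    (MemLp.toLp_eq_toLp_iff hL MemLp.zero).1 (by rw [hz]; rfl)
  refine Lp.ext ?_
  have hv : (fun x => g₁ x - g₂ x) =ᵐ[(volume : Measure Circ)] 0 := by
    exact Measure.ae_smul_measure hae (ENNReal.ofReal (2 * π))
  filter_upwards [hv] with x hx
  exact sub_eq_zero.1 hx

/-- The domain `𝒟 = {f ∈ L²(𝕋) : (c_*² - 2 η_*) f' ∈ L²(𝕋)}`. -/
def dom : Submodule ℂ L2 where
  carrier := {f | ∃ g, IsSpeedDeriv f g}
  zero_mem' := ⟨0, isSpeedDeriv_zero⟩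
  add_mem' := fun ⟨_, h₁⟩ ⟨_, h₂⟩ => ⟨_, h₁.add h₂⟩
  smul_mem' := fun a _ ⟨_, h⟩ => ⟨_, h.smul a⟩

/-- The differential part `f ↦ (c_*² - 2 η_*) f'` on `𝒟`. -/
def speedDeriv : dom →ₗ[ℂ] L2 where
  toFun f := f.2.choose
  map_add' f₁ f₂ := (f₁ + f₂).2.choose_spec.unique (f₁.2.choose_spec.add f₂.2.choose_spec)
  map_smul' a f := (a • f).2.choose_spec.unique (f.2.choose_spec.smul a)

/-! ### The bounded part -/

/-- The constant functions, as elements of `L²(𝕋)`. -/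
def constL2 : ℂ →ₗ[ℂ] L2 := Lp.constₗ 2 volume ℂ

/-- The integral `∮ f dx` over the circle. -/
def circInt : L2 →ₗ[ℂ] ℂ where
  toFun f := ∫ x : Circ, f x
  map_add' f₁ f₂ := by
    rw [← integral_add (integrable_coe f₁) (integrable_coe f₂)]
    exact integral_congr_ae (Lp.coeFn_add f₁ f₂)
  map_smul' a f := by
    rw [RingHom.id_apply, smul_eq_mul, ← integral_const_mul]
    exact integral_congr_ae (Lp.coeFn_smul a f)

theorem integrable_slope_mul (f : L2) :
    Integrable (fun x : Circ => (peakSlope x : ℂ) * f x) volume := by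
  have hs : Measurable Real.sign := by
    unfold Real.sign
    exact Measurable.ite measurableSet_Iio measurable_const
      (Measurable.ite measurableSet_Ioi measurable_const measurable_const)
  have hm : Measurable peakSlope :=
    (measurable_const.mul (measurable_const.sub
      (continuous_abs.measurable.comp measurable_rep))).mul (hs.comp measurable_rep)
  refine (integrable_coe f).bdd_mul (c := π) (Complex.measurable_ofReal.comp hm).aestronglyMeasurable
    (Filter.Eventually.of_forall fun x => ?_)
  have hx : |rep x| ≤ π := abs_le.2 ⟨(rep_mem x).1.le, (rep_mem x).2⟩
  have hx0 := abs_nonneg (rep x)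
  rw [Complex.norm_real, Real.norm_eq_abs, peakSlope]
  rcases Real.sign_apply_eq (rep x) with h | h | h <;> rw [h, abs_le] <;>
    constructor <;> linarith [pi_pos]

/-- The integral `∮ η_*' f dx` over the circle. -/
def slopeInt : L2 →ₗ[ℂ] ℂ where
  toFun f := ∫ x : Circ, (peakSlope x : ℂ) * f x
  map_add' f₁ f₂ := by
    rw [← integral_add (integrable_slope_mul f₁) (integrable_slope_mul f₂)]
    refine integral_congr_ae ?_
    filter_upwards [Lp.coeFn_add f₁ f₂] with x hx
    rw [hx, Pi.add_apply, mul_add]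
  map_smul' a f := by
    rw [RingHom.id_apply, smul_eq_mul, ← integral_const_mul]
    refine integral_congr_ae ?_
    filter_upwards [Lp.coeFn_smul a f] with x hx
    rw [hx, Pi.smul_apply, smul_eq_mul, mul_left_comm]

/-- The projection `Π₀ f = f - (1/2π) ∮ f dx` onto the functions of zero mean. -/
def proj : L2 →ₗ[ℂ] L2 := LinearMap.id - (1 / (2 * π) : ℂ) • constL2 ∘ₗ circInt

theorem intervalIntegrable_rep (f : L2) (x : Circ) :
    IntervalIntegrable (fun t : ℝ => f (t : Circ)) volume (-π) (rep x) := by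
  have h := rep_mem x
  refine (intervalIntegrable_coe f).mono_set ?_
  rw [Set.uIcc_of_le h.1.le, Set.uIcc_of_le (by linarith [pi_pos])]
  exact Set.Icc_subset_Icc_right h.2

theorem memLp_primitive (f : L2) :
    MemLp (fun x : Circ => ∫ t in (-π)..(rep x), f (t : Circ)) 2 volume := by
  have hle : -π ≤ π := by linarith [pi_pos]
  have hf := intervalIntegrable_coe f
  have hc : ContinuousOn (fun y : ℝ => ∫ t in (-π)..y, f (t : Circ)) (Set.Icc (-π) π) := by
    have := intervalIntegral.continuousOn_primitive_interval (a := -π) (b := π) (μ := volume)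
      (f := fun t : ℝ => f (t : Circ)) (by
        rw [Set.uIcc_of_le hle]
        exact (intervalIntegrable_iff_integrableOn_Icc_of_le hle).1 hf)
    rwa [Set.uIcc_of_le hle] at this
  have hm : Measurable (fun x : Circ => ∫ t in (-π)..(rep x), f (t : Circ)) := by
    have h1 : Measurable (fun y : Set.Icc (-π) π => ∫ t in (-π)..(y : ℝ), f (t : Circ)) :=
      (continuousOn_iff_continuous_domRestrict.1 hc).measurable
    have h2 : Measurable (fun x : Circ =>
        (⟨rep x, (rep_mem x).1.le, (rep_mem x).2⟩ : Set.Icc (-π) π)) :=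
      measurable_rep.subtype_mk
    exact h1.comp h2
  obtain ⟨C, hC⟩ := isCompact_Icc.exists_bound_of_continuousOn hc
  exact MemLp.of_bound hm.aestronglyMeasurable C
    (Filter.Eventually.of_forall fun x => hC _ ⟨(rep_mem x).1.le, (rep_mem x).2⟩)

/-- The primitive `x ↦ ∫_{-π}^x f(t) dt`, for `x ∈ (-π, π]`. If `f` has zero mean, this is the
periodic primitive of `f` that vanishes at `π`. -/
def primitive : L2 →ₗ[ℂ] L2 where
  toFun f := (memLp_primitive f).toLp _
  map_add' f₁ f₂ := by
    rw [← MemLp.toLp_add]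
    refine MemLp.toLp_congr _ _ (Filter.Eventually.of_forall fun x => ?_)
    rw [Pi.add_apply, ← intervalIntegral.integral_add (intervalIntegrable_rep f₁ x)
      (intervalIntegrable_rep f₂ x)]
    refine intervalIntegral.integral_congr_ae_restrict ?_
    rw [Set.uIoc_of_le (rep_mem x).1.le]
    exact ae_restrict_of_ae_restrict_of_subset (Set.Ioc_subset_Ioc_right (rep_mem x).2)
      (quasi_coe.ae (Lp.coeFn_add f₁ f₂))
  map_smul' a f := by
    rw [RingHom.id_apply, ← MemLp.toLp_const_smul]
    refine MemLp.toLp_congr _ _ (Filter.Eventually.of_forall fun x => ?_)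
    rw [Pi.smul_apply, ← intervalIntegral.integral_smul]
    refine intervalIntegral.integral_congr_ae_restrict ?_
    rw [Set.uIoc_of_le (rep_mem x).1.le]
    exact ae_restrict_of_ae_restrict_of_subset (Set.Ioc_subset_Ioc_right (rep_mem x).2)
      (quasi_coe.ae (Lp.coeFn_smul a f))

/-- The operator `Π₀ ∂_x⁻¹ Π₀`. -/
def invDeriv : L2 →ₗ[ℂ] L2 := proj ∘ₗ primitive ∘ₗ proj

/-! ### The linearized operator -/

/-- The linearized operator `A : 𝒟 ⊂ L²(𝕋) → L²(𝕋)`,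
`A f = (c_*² - 2 η_*) f' - (1/π) ∮ η_*' f dx + (1/2) Π₀ ∂_x⁻¹ Π₀ f`. -/
def linOp : L2 →ₗ.[ℂ] L2 where
  domain := dom
  toFun := speedDeriv - (1 / π : ℂ) • (constL2 ∘ₗ slopeInt ∘ₗ dom.subtype)
    + (1 / 2 : ℂ) • (invDeriv ∘ₗ dom.subtype)

/-! ### Spectra of unbounded operators -/

section Spectrum

variable {H : Type*} [NormedAddCommGroup H] [NormedSpace ℂ H]

/-- The resolvent set of an unbounded operator `T`: the `z` for which `T - z` maps the domain of `T`
bijectively onto the whole space, with a bounded inverse `R`. -/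
def resolventSet (T : H →ₗ.[ℂ] H) : Set ℂ :=
  {z | ∃ R : H →L[ℂ] H,
    (∀ g : H, ∃ f : T.domain, (f : H) = R g ∧ T f - z • (f : H) = g) ∧
    ∀ f : T.domain, R (T f - z • (f : H)) = f}

/-- The spectrum, the complement of the resolvent set. -/
def spec (T : H →ₗ.[ℂ] H) : Set ℂ := (resolventSet T)ᶜ

/-- The point spectrum, the set of eigenvalues. -/
def pointSpec (T : H →ₗ.[ℂ] H) : Set ℂ :=
  {z | ∃ f : T.domain, f ≠ 0 ∧ T f = z • (f : H)}

/-- Spectral instability of the evolution generated by (a positive multiple of) `T`: there is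
spectrum in the open right half-plane. -/
def SpectrallyUnstable (T : H →ₗ.[ℂ] H) : Prop := ∃ z ∈ spec T, 0 < z.re

end Spectrum

end PeakedWave

end

noncomputable section

namespace PeakedWave

/-! ### The coordinate on `(0, 2π]` -/

/-! Write w = c_*² - 2η_*, so that w' = -2η_*'. On (0, 2π), with the peak at both ends, w(y) = y(2π
- y)/4.

Outside the strip the argument is an energy estimate. Formally 2 Re(conj(f) w f') = (w|f|²)' -
w'|f|², and the boundary values of w|f|² must vanish: otherwise |f|² would behave like 1/w, which is
not integrable at the peak. Hence Re⟨f, w f'⟩ = ∮ η_*'|f|² (`IsSpeedDeriv.re_inner`). The nonlocal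
term is skew-adjoint, and the rank-one term is exactly what replaces f by Π₀f in this form, so Re⟨f,
Af⟩ = ∮ η_*'|Π₀f|² (`re_inner_boundedPart`). Since |η_*'| < π/4 everywhere, |Re⟨f, Af⟩| < (π/4)‖f‖²
for f ≠ 0. This confines eigenvalues to the open strip and gives ‖(A - z)f‖ ≥ (|Re z| - π/4)‖f‖. The
range of A - z is therefore closed when |Re z| > π/4. It is also dense, because a vector orthogonal
to it satisfies a weak equation with the same differential part, to which the same estimate applies
(`orthogonal_range_shifted`).

Inside the strip the eigenfunctions are explicit. With t = y/2π, μ = 2z/π and G =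
t^(1+μ)(1-t)^(1-μ), the function f = dG/dt satisfies Af = zf up to an additive constant, and the
constant is zero because both Af and f have zero mean (`mem_pointSpec_of_lt`). It lies in L² when
|Re μ| < 1/2, that is |Re z| < π/4. The boundary lines belong to the spectrum because a point of the
resolvent set keeps a positive distance from all eigenvalues (`lt_of_mem_resolventSet`). -/

/-- The representative of a point of `𝕋` in `(0, 2π]`. -/
def ang (x : Circ) : ℝ := (AddCircle.equivIoc (2 * π) 0 x : ℝ)

theorem ang_mem (x : Circ) : ang x ∈ Set.Ioc 0 (2 * π) := by
  have h := (AddCircle.equivIoc (2 * π) 0 x).2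
  exact ⟨h.1, h.2.trans_eq (by ring)⟩

theorem ang_coe {y : ℝ} (hy : y ∈ Set.Ioc 0 (2 * π)) : ang (y : Circ) = y :=
  AddCircle.equivIoc_coe_of_mem (by rwa [zero_add])

theorem coe_ang (x : Circ) : ((ang x : ℝ) : Circ) = x := AddCircle.coe_equivIoc

theorem measurePreserving_ang :
    MeasurePreserving ang volume (volume.restrict (Set.Ioc 0 (2 * π))) := by
  have h := (measurePreserving_subtype_coe (μa := (volume : Measure ℝ))
    (measurableSet_Ioc (a := (0 : ℝ)) (b := 0 + 2 * π))).comp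
    (AddCircle.measurePreserving_equivIoc (2 * π) (a := 0))
  have e : Set.Ioc 0 (2 * π) = Set.Ioc 0 (0 + 2 * π) := by rw [zero_add]
  rw [e]
  exact h

theorem measurable_ang : Measurable ang := measurePreserving_ang.measurable

theorem measurePreserving_coe :
    MeasurePreserving ((↑) : ℝ → Circ) (volume.restrict (Set.Ioc 0 (2 * π))) volume := by
  have h := AddCircle.measurePreserving_mk (2 * π) 0
  rwa [zero_add] at h

theorem ae_coe {p : Circ → Prop} (h : ∀ᵐ x, p x) :
    ∀ᵐ y : ℝ ∂(volume.restrict (Set.Ioc 0 (2 * π))), p y :=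
  measurePreserving_coe.quasiMeasurePreserving.ae h

theorem ae_of_ae_coe {p : Circ → Prop}
    (h : ∀ᵐ y : ℝ ∂(volume.restrict (Set.Ioc 0 (2 * π))), p y) : ∀ᵐ x, p x := by
  filter_upwards [measurePreserving_ang.quasiMeasurePreserving.ae h] with x hx
  rwa [coe_ang] at hx

theorem ae_mem_Ioo : ∀ᵐ y : ℝ ∂(volume.restrict (Set.Ioc 0 (2 * π))), y ∈ Set.Ioo 0 (2 * π) := by
  filter_upwards [ae_restrict_mem measurableSet_Ioc,
    ae_restrict_of_ae (Measure.ae_ne volume (2 * π))] with y hy hne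
  exact ⟨hy.1, lt_of_le_of_ne hy.2 hne⟩

theorem L2.ext_coe {f g : L2}
    (h : ∀ᵐ y : ℝ ∂(volume.restrict (Set.Ioc 0 (2 * π))), f (y : Circ) = g (y : Circ)) : f = g :=
  Lp.ext (ae_of_ae_coe h)

theorem integral_circ (F : Circ → ℂ) : ∫ x, F x = ∫ y in (0 : ℝ)..(2 * π), F (y : Circ) := by
  have h := AddCircle.intervalIntegral_preimage (2 * π) 0 F
  rw [zero_add] at h
  exact h.symm

theorem intervalIntegrable_of_integrable {F : Circ → ℂ} (hF : Integrable F) (a b : ℝ) :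
    IntervalIntegrable (fun y : ℝ => F (y : Circ)) volume a b := by
  refine Function.Periodic.intervalIntegrable₀ (T := 2 * π) (fun y => by simp)
    Real.two_pi_pos.ne' ?_ a b
  rw [intervalIntegrable_iff_integrableOn_Ioc_of_le Real.two_pi_pos.le]
  exact (measurePreserving_coe.integrable_comp hF.aestronglyMeasurable).2 hF

theorem L2.intervalIntegrable (f : L2) (a b : ℝ) :
    IntervalIntegrable (fun y : ℝ => f (y : Circ)) volume a b :=
  intervalIntegrable_of_integrable (integrable_coe f) a b

theorem intervalIntegral_congr_ae {F G : ℝ → ℂ}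
    (h : ∀ᵐ y : ℝ ∂(volume.restrict (Set.Ioc 0 (2 * π))), F y = G y) :
    ∫ y in (0 : ℝ)..(2 * π), F y = ∫ y in (0 : ℝ)..(2 * π), G y := by
  refine intervalIntegral.integral_congr_ae_restrict ?_
  rwa [Set.uIoc_of_le Real.two_pi_pos.le]

theorem inner_eq (f g : L2) :
    inner ℂ f g = ∫ y in (0 : ℝ)..(2 * π), starRingEnd ℂ (f (y : Circ)) * g (y : Circ) := by
  rw [L2.inner_def, ← integral_circ (fun x => starRingEnd ℂ (f x) * g x)]
  simp only [RCLike.inner_apply']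

theorem integrable_inner (f g : L2) :
    Integrable (fun x : Circ => starRingEnd ℂ (f x) * g x) := by
  have := MeasureTheory.L2.integrable_inner (𝕜 := ℂ) f g
  simpa only [RCLike.inner_apply'] using this

/-- In this chart the peak sits at the two endpoints, so the absolute value disappears and the
coefficient is a single polynomial vanishing to first order at each end. -/
theorem speed_coe' {y : ℝ} (hy : y ∈ Set.Ioc 0 (2 * π)) :
    speed (y : Circ) = y * (2 * π - y) / 4 := by
  rcases le_or_gt y π with h | h
  · rw [speed_coe ⟨by linarith [hy.1, pi_pos], h⟩, abs_of_pos hy.1]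
  · have e : (y : Circ) = ((y - 2 * π : ℝ) : Circ) := by
      rw [AddCircle.coe_sub, AddCircle.coe_period, sub_zero]
    rw [e, speed_coe ⟨by linarith, by linarith [hy.2, pi_pos]⟩,
      abs_of_nonpos (by linarith [hy.2])]
    ring

/-- The endpoint is excluded: since `Real.sign 0 = 0`, the value at the peak is 0 and not a
one-sided limit. -/
theorem peakSlope_coe {y : ℝ} (hy : y ∈ Set.Ioo 0 (2 * π)) :
    peakSlope (y : Circ) = -(π - y) / 4 := by
  rcases le_or_gt y π with h | h
  · rw [peakSlope, rep_coe ⟨by linarith [hy.1, pi_pos], h⟩, abs_of_pos hy.1, Real.sign_of_pos hy.1]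
    ring
  · have e : (y : Circ) = ((y - 2 * π : ℝ) : Circ) := by
      rw [AddCircle.coe_sub, AddCircle.coe_period, sub_zero]
    have hneg : y - 2 * π < 0 := by linarith [hy.2]
    rw [e, peakSlope, rep_coe ⟨by linarith, by linarith [hy.2, pi_pos]⟩,
      abs_of_neg hneg, Real.sign_of_neg hneg]
    ring

theorem measurable_peakSlope : Measurable peakSlope := by
  have hs : Measurable Real.sign := by
    unfold Real.sign
    exact Measurable.ite measurableSet_Iio measurable_const
      (Measurable.ite measurableSet_Ioi measurable_const measurable_const)
  exact (measurable_const.mul (measurable_const.sub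
      (continuous_abs.measurable.comp measurable_rep))).mul (hs.comp measurable_rep)

theorem measurable_speed : Measurable speed := by
  have := measurable_rep
  have h2 : Measurable fun x : Circ => |rep x| := continuous_abs.measurable.comp measurable_rep
  unfold speed peak
  fun_prop

theorem abs_peakSlope_le (x : Circ) : |peakSlope x| ≤ π / 4 := by
  have hx : |rep x| ≤ π := abs_le.2 ⟨(rep_mem x).1.le, (rep_mem x).2⟩
  have hx0 := abs_nonneg (rep x)
  rw [peakSlope]
  rcases Real.sign_apply_eq (rep x) with h | h | h <;> rw [h, abs_le] <;>
    constructor <;> linarith [pi_pos]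

theorem abs_speed_le (x : Circ) : |speed x| ≤ π ^ 2 := by
  have h := ang_mem x
  rw [← coe_ang x, speed_coe' h, abs_le]
  constructor <;> nlinarith [h.1, h.2, pi_pos]

/-! ### Multiplication operators -/

theorem memLp_mul {a : Circ → ℝ} (ha : Measurable a) {C : ℝ} (hC : ∀ x, |a x| ≤ C) (f : L2) :
    MemLp (fun x : Circ => (a x : ℂ) * f x) 2 volume := by
  refine MemLp.of_le_mul (c := C) (Lp.memLp f)
    ((Complex.measurable_ofReal.comp ha).aestronglyMeasurable.mul (Lp.aestronglyMeasurable f))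
    (Filter.Eventually.of_forall fun x => ?_)
  rw [norm_mul, Complex.norm_real, Real.norm_eq_abs]
  exact mul_le_mul_of_nonneg_right (hC x) (norm_nonneg _)

/-- Multiplication by a bounded measurable real function, as an operator on `L²(𝕋)`. -/
def mulOp (a : Circ → ℝ) (ha : Measurable a) (C : ℝ) (hC : ∀ x, |a x| ≤ C) : L2 →L[ℂ] L2 :=
  LinearMap.mkContinuous
    { toFun := fun f => (memLp_mul ha hC f).toLp _
      map_add' := fun f g => by
        rw [← MemLp.toLp_add]
        refine MemLp.toLp_congr _ _ ?_
        filter_upwards [Lp.coeFn_add f g] with x hx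
        rw [hx, Pi.add_apply, Pi.add_apply, mul_add]
      map_smul' := fun c f => by
        rw [RingHom.id_apply, ← MemLp.toLp_const_smul]
        refine MemLp.toLp_congr _ _ ?_
        filter_upwards [Lp.coeFn_smul c f] with x hx
        rw [hx, Pi.smul_apply, Pi.smul_apply, smul_eq_mul, smul_eq_mul, mul_left_comm] }
    C fun f => by
      refine Lp.norm_le_mul_norm_of_ae_le_mul ?_
      filter_upwards [(memLp_mul ha hC f).coeFn_toLp] with x hx
      rw [LinearMap.coe_mk, AddHom.coe_mk, hx, norm_mul, Complex.norm_real, Real.norm_eq_abs]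
      exact mul_le_mul_of_nonneg_right (hC x) (norm_nonneg _)

theorem mulOp_coeFn {a : Circ → ℝ} (ha : Measurable a) {C : ℝ} (hC : ∀ x, |a x| ≤ C) (f : L2) :
    ∀ᵐ x, mulOp a ha C hC f x = a x * f x :=
  (memLp_mul ha hC f).coeFn_toLp

theorem inner_mulOp {a : Circ → ℝ} (ha : Measurable a) {C : ℝ} (hC : ∀ x, |a x| ≤ C) (f g : L2) :
    inner ℂ (mulOp a ha C hC f) g = inner ℂ f (mulOp a ha C hC g) := by
  rw [L2.inner_def, L2.inner_def]
  refine integral_congr_ae ?_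
  filter_upwards [mulOp_coeFn ha hC f, mulOp_coeFn ha hC g] with x hf hg
  rw [hf, hg, RCLike.inner_apply', RCLike.inner_apply', map_mul, Complex.conj_ofReal]
  ring

/-- Multiplication by the slope `η_*'`. -/
def slopeMul : L2 →L[ℂ] L2 := mulOp peakSlope measurable_peakSlope (π / 4) abs_peakSlope_le

/-- Multiplication by the coefficient `c_*² - 2 η_*`. -/
def speedMul : L2 →L[ℂ] L2 := mulOp speed measurable_speed (π ^ 2) abs_speed_le

theorem inner_slopeMul (f g : L2) : inner ℂ (slopeMul f) g = inner ℂ f (slopeMul g) :=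
  inner_mulOp _ _ f g

theorem slopeMul_coe (f : L2) : ∀ᵐ y : ℝ ∂(volume.restrict (Set.Ioc 0 (2 * π))),
    slopeMul f (y : Circ) = ((-(π - y) / 4 : ℝ) : ℂ) * f (y : Circ) := by
  filter_upwards [ae_coe (mulOp_coeFn measurable_peakSlope abs_peakSlope_le f), ae_mem_Ioo]
    with y h hy
  rw [slopeMul, h, peakSlope_coe hy]

theorem speedMul_coe (f : L2) : ∀ᵐ y : ℝ ∂(volume.restrict (Set.Ioc 0 (2 * π))),
    speedMul f (y : Circ) = ((y * (2 * π - y) / 4 : ℝ) : ℂ) * f (y : Circ) := by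
  filter_upwards [ae_coe (mulOp_coeFn measurable_speed abs_speed_le f),
    ae_restrict_mem measurableSet_Ioc] with y h hy
  rw [speedMul, h, speed_coe' hy]

/-! ### Continuous functions on `[0, 2π]` as elements of `L²(𝕋)` -/

theorem memLp_ofFun {ψ : ℝ → ℂ} (hψ : Continuous ψ) :
    MemLp (fun x : Circ => ψ (ang x)) 2 volume := by
  obtain ⟨C, hC⟩ := (isCompact_Icc (a := (0 : ℝ)) (b := 2 * π)).exists_bound_of_continuousOn
    hψ.continuousOn
  exact MemLp.of_bound (hψ.measurable.comp measurable_ang).aestronglyMeasurable C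
    (Filter.Eventually.of_forall fun x => hC _ ⟨(ang_mem x).1.le, (ang_mem x).2⟩)

/-- The restriction to `(0, 2π]` of a continuous function, as an element of `L²(𝕋)`. -/
def ofFun (ψ : ℝ → ℂ) (hψ : Continuous ψ) : L2 := (memLp_ofFun hψ).toLp _

theorem ofFun_coe {ψ : ℝ → ℂ} (hψ : Continuous ψ) :
    ∀ᵐ y : ℝ ∂(volume.restrict (Set.Ioc 0 (2 * π))), ofFun ψ hψ (y : Circ) = ψ y := by
  filter_upwards [ae_coe (memLp_ofFun hψ).coeFn_toLp, ae_restrict_mem measurableSet_Ioc] with y h hy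
  rw [ofFun, h, ang_coe hy]

/-! ### The weak derivative in coordinates -/

/-- Both integrands are periodic, so the window (-π, π) can be moved to (0, 2π), where the
coefficient is smooth and the product rule holds at every interior point. -/
theorem isSpeedDeriv_iff_coord {f g : L2} : IsSpeedDeriv f g ↔
    ∀ φ : ℝ → ℂ, ContDiff ℝ ∞ φ → Function.Periodic φ (2 * π) →
      ∫ y in (0 : ℝ)..(2 * π), g (y : Circ) * φ y =
        -∫ y in (0 : ℝ)..(2 * π), f (y : Circ) * ((((π - y) / 2 : ℝ) : ℂ) * φ y +
          ((y * (2 * π - y) / 4 : ℝ) : ℂ) * deriv φ y) := by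
  have key : ∀ φ : ℝ → ℂ, ContDiff ℝ ∞ φ → Function.Periodic φ (2 * π) →
      (∫ x in (-π)..π, g (x : Circ) * φ x = ∫ y in (0 : ℝ)..(2 * π), g (y : Circ) * φ y) ∧
      (∫ x in (-π)..π, f (x : Circ) * deriv (fun y : ℝ => (speed (y : Circ) : ℂ) * φ y) x =
        ∫ y in (0 : ℝ)..(2 * π), f (y : Circ) * ((((π - y) / 2 : ℝ) : ℂ) * φ y +
          ((y * (2 * π - y) / 4 : ℝ) : ℂ) * deriv φ y)) := by
    intro φ hφ hp
    have shift : ∀ F : ℝ → ℂ, Function.Periodic F (2 * π) →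
        ∫ x in (-π)..π, F x = ∫ y in (0 : ℝ)..(2 * π), F y := by
      intro F hF
      have h := hF.intervalIntegral_add_eq (-π) 0
      rwa [zero_add, show -π + 2 * π = π by ring] at h
    refine ⟨shift _ fun y => by simp [hp y], ?_⟩
    have hq : Function.Periodic (fun y : ℝ => (speed (y : Circ) : ℂ) * φ y) (2 * π) :=
      fun y => by simp [hp y]
    rw [shift _ fun y => by
      rw [AddCircle.coe_add_period, ← deriv_comp_add_const]
      simp_rw [hq _]]
    refine intervalIntegral_congr_ae ?_
    filter_upwards [ae_mem_Ioo] with y hy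
    congr 1
    have he : (fun y : ℝ => (speed (y : Circ) : ℂ) * φ y) =ᶠ[nhds y]
        fun y : ℝ => ((y * (2 * π - y) / 4 : ℝ) : ℂ) * φ y := by
      filter_upwards [Ioo_mem_nhds hy.1 hy.2] with z hz
      rw [speed_coe' ⟨hz.1, hz.2.le⟩]
    have hd : HasDerivAt (fun y : ℝ => y * (2 * π - y) / 4) ((π - y) / 2) y := by
      have h := ((hasDerivAt_id y).mul ((hasDerivAt_id y).const_sub (2 * π))).div_const 4
      exact h.congr_deriv (by simp; ring)
    rw [he.deriv_eq]
    exact (hd.ofReal_comp.mul (hφ.differentiable (by simp) y).hasDerivAt).deriv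
  constructor
  · intro h φ hφ hp
    rw [← (key φ hφ hp).1, ← (key φ hφ hp).2]
    exact h φ hφ hp
  · intro h φ hφ hp
    rw [(key φ hφ hp).1, (key φ hφ hp).2]
    exact h φ hφ hp

theorem inner_ofFun {φ : ℝ → ℂ} (hφ : Continuous φ) (g : L2) :
    inner ℂ (ofFun φ hφ) g =
      ∫ y in (0 : ℝ)..(2 * π), g (y : Circ) * starRingEnd ℂ (φ y) := by
  rw [inner_eq]
  refine intervalIntegral_congr_ae ?_
  filter_upwards [ofFun_coe hφ] with y hy
  rw [hy, mul_comm]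

theorem speedMul_sub_slopeMul_coe (f g : L2) :
    ∀ᵐ y : ℝ ∂(volume.restrict (Set.Ioc 0 (2 * π))),
      (speedMul f - (2 : ℂ) • slopeMul g : L2) (y : Circ) =
        ((y * (2 * π - y) / 4 : ℝ) : ℂ) * f (y : Circ) +
          (((π - y) / 2 : ℝ) : ℂ) * g (y : Circ) := by
  filter_upwards [speedMul_coe f, slopeMul_coe g,
    ae_coe (Lp.coeFn_sub (speedMul f) ((2 : ℂ) • slopeMul g)),
    ae_coe (Lp.coeFn_smul (2 : ℂ) (slopeMul g))] with y h1 h2 h3 h4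
  rw [h3, Pi.sub_apply, h4, Pi.smul_apply, h1, h2, smul_eq_mul]
  push_cast
  ring

/-- Conjugating the test function turns the weak equation into inner products with fixed elements of
L². In this form it passes to limits and to adjoints. The term -2 `slopeMul` is multiplication by
w'. -/
theorem isSpeedDeriv_iff_inner {f g : L2} : IsSpeedDeriv f g ↔
    ∀ (φ : ℝ → ℂ) (hφ : ContDiff ℝ ∞ φ), Function.Periodic φ (2 * π) →
      inner ℂ (ofFun φ hφ.continuous) g =
        -inner ℂ (speedMul (ofFun (deriv φ) (hφ.continuous_deriv (by simp))) -
          (2 : ℂ) • slopeMul (ofFun φ hφ.continuous)) f := by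
  have key : ∀ (φ : ℝ → ℂ) (hφ : ContDiff ℝ ∞ φ),
      inner ℂ (speedMul (ofFun (deriv φ) (hφ.continuous_deriv (by simp))) -
          (2 : ℂ) • slopeMul (ofFun φ hφ.continuous)) f =
      ∫ y in (0 : ℝ)..(2 * π), f (y : Circ) * ((((π - y) / 2 : ℝ) : ℂ) * starRingEnd ℂ (φ y) +
          ((y * (2 * π - y) / 4 : ℝ) : ℂ) * deriv (fun y => starRingEnd ℂ (φ y)) y) := by
    intro φ hφ
    rw [inner_eq]
    refine intervalIntegral_congr_ae ?_
    filter_upwards [ofFun_coe hφ.continuous, ofFun_coe (hφ.continuous_deriv (by simp)),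
      speedMul_sub_slopeMul_coe (ofFun (deriv φ) (hφ.continuous_deriv (by simp)))
        (ofFun φ hφ.continuous)] with y h1 h2 h3
    have h4 : deriv (fun y => starRingEnd ℂ (φ y)) y = starRingEnd ℂ (deriv φ y) := deriv.star
    rw [h3, h1, h2, h4]
    simp only [map_add, map_mul, Complex.conj_ofReal]
    ring
  rw [isSpeedDeriv_iff_coord]
  constructor
  · intro h φ hφ hp
    rw [inner_ofFun, key φ hφ]
    exact h (fun y => starRingEnd ℂ (φ y)) (Complex.conjCLE.contDiff.comp hφ) fun y => by
      simp only [hp y]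
  · intro h φ hφ hp
    have hc : ContDiff ℝ ∞ (fun y => starRingEnd ℂ (φ y)) := Complex.conjCLE.contDiff.comp hφ
    have e := h (fun y => starRingEnd ℂ (φ y)) hc fun y => by simp only [hp y]
    rw [inner_ofFun, key _ hc] at e
    simpa only [Complex.conj_conj] using e

/-- Integration by parts leaves no boundary term because w vanishes at 0 and 2π; periodicity of φ is
not needed. -/
theorem isSpeedDeriv_ofFun {φ : ℝ → ℂ} (hφ : ContDiff ℝ ∞ φ) :
    IsSpeedDeriv (ofFun φ hφ.continuous)
      (speedMul (ofFun (deriv φ) (hφ.continuous_deriv (by simp)))) := by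
  rw [isSpeedDeriv_iff_coord]
  intro ψ hψ _
  have cφ := hφ.continuous
  have cψ := hψ.continuous
  have cφ' := hφ.continuous_deriv (by simp)
  have cψ' := hψ.continuous_deriv (by simp)
  have e1 : ∫ y in (0 : ℝ)..(2 * π),
      speedMul (ofFun (deriv φ) cφ') (y : Circ) * ψ y =
      ∫ y in (0 : ℝ)..(2 * π), ((y * (2 * π - y) / 4 : ℝ) : ℂ) * deriv φ y * ψ y := by
    refine intervalIntegral_congr_ae ?_
    filter_upwards [ofFun_coe cφ', speedMul_coe (ofFun (deriv φ) cφ')] with y h1 h2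
    rw [h2, h1]
  have e2 : ∫ y in (0 : ℝ)..(2 * π), ofFun φ cφ (y : Circ) * ((((π - y) / 2 : ℝ) : ℂ) * ψ y +
          ((y * (2 * π - y) / 4 : ℝ) : ℂ) * deriv ψ y) =
      ∫ y in (0 : ℝ)..(2 * π), φ y * ((((π - y) / 2 : ℝ) : ℂ) * ψ y +
          ((y * (2 * π - y) / 4 : ℝ) : ℂ) * deriv ψ y) := by
    refine intervalIntegral_congr_ae ?_
    filter_upwards [ofFun_coe cφ] with y h1
    rw [h1]
  rw [e1, e2, eq_neg_iff_add_eq_zero, ← intervalIntegral.integral_add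
    (Continuous.intervalIntegrable (by fun_prop) _ _)
    (Continuous.intervalIntegrable (by fun_prop) _ _)]
  rw [intervalIntegral.integral_eq_sub_of_hasDerivAt
    (f := fun y : ℝ => ((y * (2 * π - y) / 4 : ℝ) : ℂ) * φ y * ψ y)]
  · simp
  · intro y _
    have hd : HasDerivAt (fun y : ℝ => y * (2 * π - y) / 4) ((π - y) / 2) y := by
      have h := ((hasDerivAt_id y).mul ((hasDerivAt_id y).const_sub (2 * π))).div_const 4
      exact h.congr_deriv (by simp; ring)
    have h := (hd.ofReal_comp.mul (hφ.differentiable (by simp) y).hasDerivAt).mul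
      (hψ.differentiable (by simp) y).hasDerivAt
    refine h.congr_deriv ?_
    simp only [Pi.mul_apply]
    ring
  · exact Continuous.intervalIntegrable (by fun_prop) _ _

/-- The differential part is a closed operator. -/
theorem IsSpeedDeriv.of_tendsto {f g : ℕ → L2} {f₀ g₀ : L2} (h : ∀ n, IsSpeedDeriv (f n) (g n))
    (hf : Filter.Tendsto f Filter.atTop (nhds f₀)) (hg : Filter.Tendsto g Filter.atTop (nhds g₀)) :
    IsSpeedDeriv f₀ g₀ := by
  rw [isSpeedDeriv_iff_inner]
  intro φ hφ hp
  refine tendsto_nhds_unique ((tendsto_const_nhds).inner hg) ?_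
  simp_rw [fun n => isSpeedDeriv_iff_inner.1 (h n) φ hφ hp]
  exact (tendsto_const_nhds.inner hf).neg

/-! ### Complex absolutely continuous functions -/

theorem absolutelyContinuousOnInterval_const {E : Type*} [NormedAddCommGroup E] (c : E) (a b : ℝ) :
    AbsolutelyContinuousOnInterval (fun _ : ℝ => c) a b :=
  (LipschitzWith.const c).lipschitzOnWith.absolutelyContinuousOnInterval

theorem _root_.AbsolutelyContinuousOnInterval.ofReal {f : ℝ → ℝ} {a b : ℝ}
    (hf : AbsolutelyContinuousOnInterval f a b) :
    AbsolutelyContinuousOnInterval (fun x => (f x : ℂ)) a b := by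
  have h := hf.fun_smul (absolutelyContinuousOnInterval_const (1 : ℂ) a b)
  simpa using h

theorem absolutelyContinuousOnInterval_primitive {f : ℝ → ℂ} {a b c : ℝ}
    (hf : IntervalIntegrable f volume a b) (hc : c ∈ Set.uIcc a b) :
    AbsolutelyContinuousOnInterval (fun x => ∫ t in c..x, f t) a b := by
  have hre : IntervalIntegrable (fun t => (f t).re) volume a b := ⟨hf.1.re, hf.2.re⟩
  have him : IntervalIntegrable (fun t => (f t).im) volume a b := ⟨hf.1.im, hf.2.im⟩
  have h := (hre.absolutelyContinuousOnInterval_intervalIntegral hc).ofReal.fun_add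
    ((him.absolutelyContinuousOnInterval_intervalIntegral hc).ofReal.const_smul Complex.I)
  have hfc : ∀ x ∈ Set.uIcc a b, IntervalIntegrable f volume c x := fun x hx =>
    hf.mono_set (Set.uIcc_subset_uIcc hc hx)
  have e : ∀ x ∈ Set.uIcc a b, ∫ t in c..x, f t =
      ((∫ t in c..x, (f t).re : ℝ) : ℂ) + Complex.I • ((∫ t in c..x, (f t).im : ℝ) : ℂ) := by
    intro x hx
    have i1 : IntervalIntegrable (fun t => (f t).re) volume c x :=
      hre.mono_set (Set.uIcc_subset_uIcc hc hx)
    have i2 : IntervalIntegrable (fun t => (f t).im) volume c x :=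
      him.mono_set (Set.uIcc_subset_uIcc hc hx)
    rw [← intervalIntegral.integral_ofReal, ← intervalIntegral.integral_ofReal,
      ← intervalIntegral.integral_smul, ← intervalIntegral.integral_add]
    · refine intervalIntegral.integral_congr fun t _ => ?_
      rw [smul_eq_mul, mul_comm, Complex.re_add_im]
    · exact ⟨i1.1.ofReal, i1.2.ofReal⟩
    · exact IntervalIntegrable.const_mul (f := fun t => ((f t).im : ℂ)) ⟨i2.1.ofReal, i2.2.ofReal⟩ _
  rw [absolutelyContinuousOnInterval_iff] at h ⊢
  intro ε hε
  obtain ⟨δ, hδ, H⟩ := h ε hε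
  refine ⟨δ, hδ, fun E hE hs => ?_⟩
  refine lt_of_eq_of_lt (Finset.sum_congr rfl fun i hi => ?_) (H E hE hs)
  rw [e _ (hE.1 i hi).1, e _ (hE.1 i hi).2]

/-- Subtracting the primitive of f' leaves an absolutely continuous function with derivative zero
almost everywhere, hence a constant. -/
theorem _root_.AbsolutelyContinuousOnInterval.integral_eq_sub {f f' : ℝ → ℂ} {a b : ℝ}
    (hf : AbsolutelyContinuousOnInterval f a b) (hi : IntervalIntegrable f' volume a b)
    (hd : ∀ᵐ x, x ∈ Set.uIcc a b → HasDerivAt f (f' x) x) :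
    ∫ x in a..b, f' x = f b - f a := by
  have hp := absolutelyContinuousOnInterval_primitive hi Set.left_mem_uIcc
  obtain ⟨C, hC⟩ := (hf.fun_sub hp).const_of_ae_hasDerivAt_zero (by
    filter_upwards [hd, hi.ae_hasDerivAt_integral] with x h1 h2 hx
    exact ((h1 hx).fun_sub (h2 hx a Set.left_mem_uIcc)).congr_deriv (sub_self _))
  have ha := hC a Set.left_mem_uIcc
  have hb := hC b Set.right_mem_uIcc
  simp only [intervalIntegral.integral_same, sub_zero] at ha hb
  rw [ha, ← hb]
  ring

/-! ### The energy identity -/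

/-- The du Bois-Reymond lemma on the circle: testing against exponentials annihilates every Fourier
coefficient except the zeroth. -/
theorem ae_const_of_integral_mul_deriv {d : L2}
    (h : ∀ φ : ℝ → ℂ, ContDiff ℝ ∞ φ → Function.Periodic φ (2 * π) →
      ∫ y in (0 : ℝ)..(2 * π), d (y : Circ) * deriv φ y = 0) :
    ∃ c : ℂ, ∀ᵐ x : Circ, d x = c := by
  have hL : MemLp (fun x => d x) 2 (AddCircle.haarAddCircle (T := 2 * π)) :=
    memLp_haarAddCircle_iff.2 (Lp.memLp d)
  have hc : ∀ n : ℤ, n ≠ 0 → fourierCoeff (fun x => d x) n = 0 := by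
    intro n hn
    rw [fourierCoeff_eq_intervalIntegral _ n 0, zero_add]
    have e := h _ (contDiff_fourier (-n)) (fun x => by simp)
    have hd : ∀ y : ℝ, deriv (fun x : ℝ => (fourier (-n) (x : Circ) : ℂ)) y =
        (2 * π * Complex.I * (-n : ℤ) / (2 * π : ℝ)) * fourier (-n) (y : Circ) := fun y =>
      (hasDerivAt_fourier (2 * π) (-n) y).deriv
    have hne : (2 * π * Complex.I * (-n : ℤ) / (2 * π : ℝ) : ℂ) ≠ 0 := by
      have : (π : ℂ) ≠ 0 := by exact_mod_cast pi_ne_zero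
      simp [hn, this]
    have e2 : ∫ y in (0 : ℝ)..(2 * π), fourier (-n) (y : Circ) • d (y : Circ) = 0 := by
      refine (mul_eq_zero.1 (?_ : (2 * π * Complex.I * (-n : ℤ) / (2 * π : ℝ) : ℂ) * _ = 0)
        ).resolve_left hne
      rw [← intervalIntegral.integral_const_mul, ← e]
      refine intervalIntegral.integral_congr fun y _ => ?_
      simp only [hd, smul_eq_mul]
      ring
    rw [e2, smul_zero]
  have hz : hL.toLp _ = fourierCoeff (fun x => d x) 0 • fourierBasis (T := 2 * π) 0 := by
    apply fourierBasis.repr.injective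
    ext n
    rw [fourierBasis_repr, fourierCoeff_congr_ae hL.coeFn_toLp, map_smul, HilbertBasis.repr_self]
    by_cases hn : n = 0
    · subst hn; simp
    · rw [hc n hn]; simp [hn]
  refine ⟨fourierCoeff (fun x => d x) 0, ?_⟩
  have h1 := hL.coeFn_toLp
  rw [hz] at h1
  have h2 : ((fourierBasis (T := 2 * π) 0 : Lp ℂ 2 AddCircle.haarAddCircle) : Circ → ℂ)
      =ᵐ[AddCircle.haarAddCircle] fourier 0 := by
    rw [coe_fourierBasis]; exact coeFn_fourierLp 2 0
  have h3 : (fun x => d x) =ᵐ[AddCircle.haarAddCircle (T := 2 * π)]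
      fun _ => fourierCoeff (fun x => d x) 0 := by
    filter_upwards [h1, h2, Lp.coeFn_smul (fourierCoeff (fun x => d x) 0)
      (fourierBasis (T := 2 * π) 0 : Lp ℂ 2 AddCircle.haarAddCircle)] with x e1 e2 e3
    rw [← e1, e3, Pi.smul_apply, e2]
    simp
  exact Measure.ae_smul_measure h3 (ENNReal.ofReal (2 * π))

/-- Zero mean makes -π and π interchangeable as base points. Points y > π are represented by y - 2π,
and a shift by 2π moves their base point from -π to π as well. -/
theorem primitive_coe {f : L2} (hf : circInt f = 0) :
    ∀ᵐ y : ℝ ∂(volume.restrict (Set.Ioc 0 (2 * π))),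
      primitive f (y : Circ) = ∫ t in π..y, f (t : Circ) := by
  filter_upwards [ae_coe (memLp_primitive f).coeFn_toLp, ae_restrict_mem measurableSet_Ioc]
    with y h hy
  have e : primitive f = (memLp_primitive f).toLp _ := rfl
  have i := f.intervalIntegrable
  have hz : ∫ t in (-π)..π, f (t : Circ) = 0 := by
    have h2 := AddCircle.intervalIntegral_preimage (2 * π) (-π) f
    rw [show -π + 2 * π = π by ring] at h2
    rw [h2]
    exact hf
  rw [e, h]
  rcases le_or_gt y π with hle | hlt
  · rw [rep_coe ⟨by linarith [hy.1, pi_pos], hle⟩,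
      ← intervalIntegral.integral_add_adjacent_intervals (i (-π) π) (i π y), hz, zero_add]
  · have e2 : (y : Circ) = ((y - 2 * π : ℝ) : Circ) := by
      rw [AddCircle.coe_sub, AddCircle.coe_period, sub_zero]
    rw [e2, rep_coe ⟨by linarith, by linarith [hy.2, pi_pos]⟩]
    have h3 := intervalIntegral.integral_comp_add_right (a := -π) (b := y - 2 * π)
      (fun t : ℝ => f (t : Circ)) (2 * π)
    simp only [AddCircle.coe_add_period] at h3
    rw [h3]
    congr 1 <;> ring

/-- If `w f' = g` weakly, then `w f` has a continuous representative which is an antiderivative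
of `g + w' f`. -/
theorem IsSpeedDeriv.exists_primitive {f g : L2} (h : IsSpeedDeriv f g) :
    ∃ c : ℂ, ∀ᵐ y : ℝ ∂(volume.restrict (Set.Ioc 0 (2 * π))),
      ((y * (2 * π - y) / 4 : ℝ) : ℂ) * f (y : Circ) =
        c + ∫ t in π..y, (g - (2 : ℂ) • slopeMul f : L2) (t : Circ) := by
  set k : L2 := g - (2 : ℂ) • slopeMul f with hk
  have hkc : ∀ᵐ y : ℝ ∂(volume.restrict (Set.Ioc 0 (2 * π))),
      k (y : Circ) = g (y : Circ) + (((π - y) / 2 : ℝ) : ℂ) * f (y : Circ) := by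
    filter_upwards [slopeMul_coe f, ae_coe (Lp.coeFn_sub g ((2 : ℂ) • slopeMul f)),
      ae_coe (Lp.coeFn_smul (2 : ℂ) (slopeMul f))] with y h2 h3 h4
    rw [hk, h3, Pi.sub_apply, h4, Pi.smul_apply, h2, smul_eq_mul]
    push_cast
    ring
  have ik := k.intervalIntegrable
  -- The product rule in weak form: (w f)' = g + w' f = k.
  have hw : ∀ φ : ℝ → ℂ, ContDiff ℝ ∞ φ → Function.Periodic φ (2 * π) →
      ∫ y in (0 : ℝ)..(2 * π), speedMul f (y : Circ) * deriv φ y =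
        -∫ y in (0 : ℝ)..(2 * π), k (y : Circ) * φ y := by
    intro φ hφ hp
    have e := isSpeedDeriv_iff_coord.1 h φ hφ hp
    have cφ := hφ.continuous
    have cφ' := hφ.continuous_deriv (by simp)
    have e1 : ∫ y in (0 : ℝ)..(2 * π), f (y : Circ) * ((((π - y) / 2 : ℝ) : ℂ) * φ y +
          ((y * (2 * π - y) / 4 : ℝ) : ℂ) * deriv φ y) =
        (∫ y in (0 : ℝ)..(2 * π), f (y : Circ) * ((((π - y) / 2 : ℝ) : ℂ) * φ y)) +
        ∫ y in (0 : ℝ)..(2 * π), speedMul f (y : Circ) * deriv φ y := by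
      rw [← intervalIntegral.integral_add
        ((f.intervalIntegrable _ _).mul_continuousOn (by fun_prop))
        (((speedMul f).intervalIntegrable _ _).mul_continuousOn (by fun_prop))]
      refine intervalIntegral_congr_ae ?_
      filter_upwards [speedMul_coe f] with y hy
      rw [hy]
      ring
    have e2 : ∫ y in (0 : ℝ)..(2 * π), k (y : Circ) * φ y =
        (∫ y in (0 : ℝ)..(2 * π), g (y : Circ) * φ y) +
        ∫ y in (0 : ℝ)..(2 * π), f (y : Circ) * ((((π - y) / 2 : ℝ) : ℂ) * φ y) := by
      rw [← intervalIntegral.integral_add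
        ((g.intervalIntegrable _ _).mul_continuousOn (by fun_prop))
        ((f.intervalIntegrable _ _).mul_continuousOn (by fun_prop))]
      refine intervalIntegral_congr_ae ?_
      filter_upwards [hkc] with y hy
      rw [hy]
      ring
    rw [e2, e, e1]
    ring
  -- The test function 1 shows that k has zero mean, so its primitive is periodic.
  have hk0 : ∫ y in (0 : ℝ)..(2 * π), k (y : Circ) = 0 := by
    have e := hw (fun _ => 1) contDiff_const (fun _ => rfl)
    simpa using e.symm
  have hkz : circInt k = 0 := (integral_circ k).trans hk0
  -- Both w f and the primitive of k have weak derivative k, so they differ by a constant.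
  obtain ⟨c, hc⟩ := ae_const_of_integral_mul_deriv (d := speedMul f - primitive k) (by
    intro φ hφ hp
    have cφ := hφ.continuous
    have cφ' := hφ.continuous_deriv (by simp)
    have e1 : ∫ y in (0 : ℝ)..(2 * π), (speedMul f - primitive k : L2) (y : Circ) * deriv φ y =
        (∫ y in (0 : ℝ)..(2 * π), speedMul f (y : Circ) * deriv φ y) -
        ∫ y in (0 : ℝ)..(2 * π), (∫ t in π..y, k (t : Circ)) * deriv φ y := by
      rw [← intervalIntegral.integral_sub
        (((speedMul f).intervalIntegrable _ _).mul_continuousOn (by fun_prop))]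
      · refine intervalIntegral_congr_ae ?_
        filter_upwards [primitive_coe hkz, ae_coe (Lp.coeFn_sub (speedMul f) (primitive k))]
          with y h1 h2
        rw [h2, Pi.sub_apply, h1]
        ring
      · exact ((intervalIntegral.continuous_primitive ik π).mul cφ').intervalIntegrable _ _
    have ip : IntervalIntegrable (fun y => (∫ t in π..y, k (t : Circ)) * deriv φ y) volume 0
        (2 * π) :=
      ((intervalIntegral.continuous_primitive ik π).mul cφ').intervalIntegrable _ _
    have hπ : π ∈ Set.uIcc 0 (2 * π) := by
      rw [Set.uIcc_of_le Real.two_pi_pos.le]; constructor <;> linarith [pi_pos]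
    have e2 := AbsolutelyContinuousOnInterval.integral_eq_sub (a := 0) (b := 2 * π)
      (f := fun y => (∫ t in π..y, k (t : Circ)) * φ y)
      (f' := fun y => k (y : Circ) * φ y + (∫ t in π..y, k (t : Circ)) * deriv φ y)
      ((absolutelyContinuousOnInterval_primitive (ik _ _) hπ).fun_smul
        ((hφ.of_le (by simp)).contDiffOn.absolutelyContinuousOnInterval))
      (((ik _ _).mul_continuousOn (by fun_prop)).add ip) (by
        filter_upwards [(ik 0 (2 * π)).ae_hasDerivAt_integral] with y hy hm
        exact (hy hm π hπ).mul (hφ.differentiable (by simp) y).hasDerivAt)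
    rw [intervalIntegral.integral_add ((ik _ _).mul_continuousOn (by fun_prop)) ip] at e2
    have e3 : φ (2 * π) = φ 0 := by simpa using hp 0
    have e4 : ∫ t in π..(2 * π), k (t : Circ) = ∫ t in π..0, k (t : Circ) := by
      rw [← intervalIntegral.integral_add_adjacent_intervals (ik π 0) (ik 0 (2 * π)), hk0, add_zero]
    rw [e3, e4, sub_self] at e2
    rw [e1, hw φ hφ hp]
    linear_combination -e2)
  refine ⟨c, ?_⟩
  filter_upwards [ae_coe hc, primitive_coe hkz, speedMul_coe f,
    ae_coe (Lp.coeFn_sub (speedMul f) (primitive k))] with y h1 h2 h3 h4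
  rw [h4, Pi.sub_apply, h2, h3] at h1
  rw [← h1]
  ring

theorem _root_.AbsolutelyContinuousOnInterval.conj {f : ℝ → ℂ} {a b : ℝ}
    (hf : AbsolutelyContinuousOnInterval f a b) :
    AbsolutelyContinuousOnInterval (fun x => starRingEnd ℂ (f x)) a b := by
  rw [absolutelyContinuousOnInterval_iff] at hf ⊢
  simpa only [Complex.dist_conj_conj] using hf

/-- A simple pole with nonzero coefficient is not integrable. This excludes nonzero boundary values
of w|f|² at the peak. -/
theorem not_intervalIntegrable_div_sub_mul {Ψ q : ℝ → ℂ} {a b c : ℝ} (hΨ : ContinuousAt Ψ c)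
    (hq : ContinuousAt q c) (hΨc : Ψ c ≠ 0) (hqc : q c ≠ 0) (hne : a ≠ b) (hc : c ∈ Set.uIcc a b) :
    ¬ IntervalIntegrable (fun x => Ψ x / (((x - c : ℝ) : ℂ) * q x)) volume a b := by
  refine not_intervalIntegrable_of_sub_inv_isBigO_punctured ?_ hne hc
  have h1 : (fun x => q x / Ψ x) =O[nhdsWithin c {c}ᶜ] fun _ => (1 : ℂ) :=
    ((hq.div hΨ hΨc).isBigO_one ℂ).mono nhdsWithin_le_nhds
  have h2 : (fun x : ℝ => (((x - c)⁻¹ : ℝ) : ℂ)) =O[nhdsWithin c {c}ᶜ]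
      fun x => Ψ x / (((x - c : ℝ) : ℂ) * q x) := by
    have h3 := (Asymptotics.isBigO_refl (fun x => Ψ x / (((x - c : ℝ) : ℂ) * q x))
      (nhdsWithin c {c}ᶜ)).mul h1
    refine h3.congr' ?_ (Filter.Eventually.of_forall fun x => mul_one _)
    filter_upwards [nhdsWithin_le_nhds (hΨ.eventually_ne hΨc),
      nhdsWithin_le_nhds (hq.eventually_ne hqc), self_mem_nhdsWithin] with x e1 e2 e3
    have e4 : ((x - c : ℝ) : ℂ) ≠ 0 := by
      rw [Complex.ofReal_ne_zero, sub_ne_zero]; exact e3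
    rw [Complex.ofReal_inv]
    field_simp
  have h4 := h2.norm_left
  simp only [Complex.norm_real] at h4
  exact h4.of_norm_left

/-- Integrate (w|f|²)' = 2 Re(conj(f) g) + w'|f|² over the circle cut at the peak. The boundary
terms vanish because f is square integrable, and w' = -2η_*' gives the right-hand side. -/
theorem IsSpeedDeriv.re_inner {f g : L2} (h : IsSpeedDeriv f g) :
    (inner ℂ f g).re = (inner ℂ f (slopeMul f)).re := by
  obtain ⟨c, hc⟩ := h.exists_primitive
  set k : L2 := g - (2 : ℂ) • slopeMul f with hk
  have hkc : ∀ᵐ y : ℝ ∂(volume.restrict (Set.Ioc 0 (2 * π))),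
      k (y : Circ) = g (y : Circ) + (((π - y) / 2 : ℝ) : ℂ) * f (y : Circ) := by
    filter_upwards [slopeMul_coe f, ae_coe (Lp.coeFn_sub g ((2 : ℂ) • slopeMul f)),
      ae_coe (Lp.coeFn_smul (2 : ℂ) (slopeMul f))] with y h2 h3 h4
    rw [hk, h3, Pi.sub_apply, h4, Pi.smul_apply, h2, smul_eq_mul]
    push_cast
    ring
  -- `J` is the integrable function that will be the derivative of w|f|².
  set J : Circ → ℂ := fun x => starRingEnd ℂ (f x) * g x + starRingEnd ℂ (g x) * f x -
    2 * (starRingEnd ℂ (f x) * slopeMul f x) with hJ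
  have iJ' : Integrable J :=
    ((integrable_inner f g).add (integrable_inner g f)).sub
      ((integrable_inner f (slopeMul f)).const_mul 2)
  have iJ := intervalIntegrable_of_integrable iJ'
  have hsum : ∫ y in (0 : ℝ)..(2 * π), J (y : Circ) =
      inner ℂ f g + inner ℂ g f - 2 * inner ℂ f (slopeMul f) := by
    rw [inner_eq, inner_eq, inner_eq, ← intervalIntegral.integral_const_mul,
      ← intervalIntegral.integral_add, ← intervalIntegral.integral_sub]
    · exact intervalIntegrable_of_integrable ((integrable_inner f g).add (integrable_inner g f)) _ _
    · exact (intervalIntegrable_of_integrable (integrable_inner f (slopeMul f)) _ _).const_mul 2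
    · exact intervalIntegrable_of_integrable (integrable_inner f g) _ _
    · exact intervalIntegrable_of_integrable (integrable_inner g f) _ _
  have ik := k.intervalIntegrable
  set P : ℝ → ℂ := fun y => c + ∫ t in π..y, k (t : Circ) with hP
  set w : ℝ → ℝ := fun y => y * (2 * π - y) / 4 with hw
  have hwd : ∀ y, HasDerivAt w ((π - y) / 2) y := fun y => by
    have h := ((hasDerivAt_id y).mul ((hasDerivAt_id y).const_sub (2 * π))).div_const 4
    exact h.congr_deriv (by simp; ring)
  have hwne : ∀ y ∈ Set.Ioo 0 (2 * π), w y ≠ 0 := fun y hy =>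
    (div_pos (mul_pos hy.1 (by linarith [hy.2])) (by norm_num)).ne'
  have hπ : π ∈ Set.Ioo 0 (2 * π) := ⟨pi_pos, by linarith [pi_pos]⟩
  -- With P = w f, this is |P|²/w = w|f|² on (0, 2π), extended continuously past the endpoints by
  -- integrating `J` from π.
  set Ψ : ℝ → ℂ := fun x => P π * starRingEnd ℂ (P π) * ((w π)⁻¹ : ℝ) +
    ∫ t in π..x, J (t : Circ) with hΨ
  have cΨ : Continuous Ψ := continuous_const.add (intervalIntegral.continuous_primitive iJ π)
  have key : ∀ x ∈ Set.Ioo 0 (2 * π), P x * starRingEnd ℂ (P x) * ((w x)⁻¹ : ℝ) = Ψ x := by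
    intro x hx
    have hsub : Set.uIcc π x ⊆ Set.Ioo 0 (2 * π) := Set.OrdConnected.uIcc_subset inferInstance hπ hx
    have hPac : AbsolutelyContinuousOnInterval P π x :=
      (absolutelyContinuousOnInterval_const c π x).fun_add
        (absolutelyContinuousOnInterval_primitive (ik _ _) Set.left_mem_uIcc)
    have hwac : AbsolutelyContinuousOnInterval (fun y => (w y)⁻¹) π x := by
      refine ContDiffOn.absolutelyContinuousOnInterval (ContDiffOn.inv ?_
        fun y hy => hwne y (hsub hy))
      exact ContDiff.contDiffOn (by fun_prop)
    have e := AbsolutelyContinuousOnInterval.integral_eq_sub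
      (f := fun y => P y * starRingEnd ℂ (P y) * ((w y)⁻¹ : ℝ)) (f' := fun y => J (y : Circ))
      ((hPac.fun_smul hPac.conj).fun_smul hwac.ofReal) (iJ _ _) (by
        filter_upwards [(ae_restrict_iff' measurableSet_Ioc).1 hc,
          (ae_restrict_iff' measurableSet_Ioc).1 hkc,
          (ae_restrict_iff' measurableSet_Ioc).1 (slopeMul_coe f),
          (ik π x).ae_hasDerivAt_integral] with y h1 h2 h3 h4 hy
        have hy' := Set.Ioo_subset_Ioc_self (hsub hy)
        have dP : HasDerivAt P (k (y : Circ)) y :=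
          (h4 hy π Set.left_mem_uIcc).const_add c
        have dPc : HasDerivAt (fun y => starRingEnd ℂ (P y)) (starRingEnd ℂ (k (y : Circ))) y :=
          dP.star
        have dw := ((hwd y).inv (hwne y (hsub hy))).ofReal_comp
        refine ((dP.mul dPc).mul dw).congr_deriv ?_
        have hw0 : (w y : ℂ) ≠ 0 := Complex.ofReal_ne_zero.2 (hwne y (hsub hy))
        have hPy : P y = (w y : ℂ) * f (y : Circ) := (h1 hy').symm
        simp only [hJ, Pi.mul_apply, Pi.inv_apply]
        rw [hPy, h2 hy', h3 hy']
        simp only [map_add, map_mul, Complex.conj_ofReal]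
        push_cast
        field_simp
        ring)
    simp only [hΨ]
    rw [e]
    ring
  have hff : IntervalIntegrable (fun y : ℝ => Ψ y / (w y : ℂ)) volume 0 (2 * π) := by
    refine (intervalIntegrable_of_integrable (integrable_inner f f) 0 (2 * π)).congr_ae ?_
    rw [Set.uIoc_of_le Real.two_pi_pos.le]
    filter_upwards [hc, ae_mem_Ioo] with y h1 hy
    have hw0 : (w y : ℂ) ≠ 0 := Complex.ofReal_ne_zero.2 (hwne y hy)
    have hPy : P y = (w y : ℂ) * f (y : Circ) := h1.symm
    rw [← key y hy, hPy]
    simp only [map_mul, Complex.conj_ofReal, Complex.ofReal_inv]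
    field_simp
  -- Near 0, w = y · (2π - y)/4, so a nonzero limit would make |f|² = Ψ/w nonintegrable. At 2π the
  -- factorization is w = (y - 2π) · (-y/4).
  have h0 : Ψ 0 = 0 := by
    by_contra hne
    refine not_intervalIntegrable_div_sub_mul (Ψ := Ψ) (q := fun y => ((2 * π - y) / 4 : ℝ))
      cΨ.continuousAt (by fun_prop) hne ?_ Real.two_pi_pos.ne (c := 0) Set.left_mem_uIcc ?_
    · rw [Complex.ofReal_ne_zero, sub_zero]; positivity
    · refine hff.congr fun y _ => ?_
      simp only [hw]
      rw [← Complex.ofReal_mul]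
      congr 2
      ring
  have h1 : Ψ (2 * π) = 0 := by
    by_contra hne
    refine not_intervalIntegrable_div_sub_mul (Ψ := Ψ) (q := fun y => (-y / 4 : ℝ))
      cΨ.continuousAt (by fun_prop) hne ?_ Real.two_pi_pos.ne (c := 2 * π) Set.right_mem_uIcc ?_
    · rw [Complex.ofReal_ne_zero]; have := pi_pos; exact (by linarith : -(2 * π) / 4 < 0).ne
    · refine hff.congr fun y _ => ?_
      simp only [hw]
      rw [← Complex.ofReal_mul]
      congr 2
      ring
  have hz : ∫ y in (0 : ℝ)..(2 * π), J (y : Circ) = 0 := by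
    rw [← intervalIntegral.integral_add_adjacent_intervals (iJ 0 π) (iJ π (2 * π)),
      intervalIntegral.integral_symm π 0]
    have e : Ψ (2 * π) - Ψ 0 = 0 := by rw [h0, h1, sub_zero]
    rw [← e]
    simp only [hΨ]
    ring
  rw [hsum, ← inner_conj_symm g f] at hz
  have hr := congrArg Complex.re hz
  simp only [Complex.sub_re, Complex.add_re, Complex.conj_re, Complex.mul_re, Complex.re_ofNat,
    Complex.im_ofNat, Complex.zero_re, zero_mul, sub_zero] at hr
  linarith

/-! ### The bounded part of the operator -/

theorem constL2_coeFn (a : ℂ) : ∀ᵐ x, constL2 a x = a := Lp.coeFn_const 2 volume a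

theorem constL2_eq_smul (a : ℂ) : constL2 a = a • constL2 1 := by
  rw [← map_smul, smul_eq_mul, mul_one]

theorem circInt_eq_inner (f : L2) : circInt f = inner ℂ (constL2 1) f := by
  rw [L2.inner_def]
  refine integral_congr_ae ?_
  filter_upwards [constL2_coeFn 1] with x hx
  rw [RCLike.inner_apply', hx, map_one, one_mul]

theorem slopeInt_eq (f : L2) : slopeInt f = circInt (slopeMul f) := by
  refine integral_congr_ae ?_
  filter_upwards [mulOp_coeFn measurable_peakSlope abs_peakSlope_le f] with x hx
  rw [slopeMul, hx]

theorem circInt_const (a : ℂ) : circInt (constL2 a) = 2 * π * a := by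
  refine (integral_congr_ae (constL2_coeFn a)).trans ?_
  rw [integral_circ, intervalIntegral.integral_const, sub_zero, Complex.real_smul]
  push_cast
  ring

theorem slopeInt_const (a : ℂ) : slopeInt (constL2 a) = 0 := by
  rw [slopeInt_eq]
  refine (integral_circ _).trans ?_
  have e : ∫ y in (0 : ℝ)..(2 * π), slopeMul (constL2 a) (y : Circ) =
      ∫ y in (0 : ℝ)..(2 * π), ((-(π - y) / 4 : ℝ) : ℂ) * a := by
    refine intervalIntegral_congr_ae ?_
    filter_upwards [slopeMul_coe (constL2 a), ae_coe (constL2_coeFn a)] with y h1 h2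
    rw [h1, h2]
  rw [e, intervalIntegral.integral_mul_const, intervalIntegral.integral_ofReal]
  have e2 : ∫ y in (0 : ℝ)..(2 * π), -(π - y) / 4 = 0 := by
    rw [intervalIntegral.integral_eq_sub_of_hasDerivAt (f := fun y => (y ^ 2 / 2 - π * y) / 4)]
    · ring
    · intro y _
      have h := ((((hasDerivAt_id y).pow 2).div_const 2).sub
        ((hasDerivAt_id y).const_mul π)).div_const 4
      exact h.congr_deriv (by simp)
    · exact Continuous.intervalIntegrable (by fun_prop) _ _
  rw [e2, Complex.ofReal_zero, zero_mul]

theorem proj_apply (f : L2) : proj f = f - (1 / (2 * π) : ℂ) • constL2 (circInt f) := rfl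

theorem circInt_proj (f : L2) : circInt (proj f) = 0 := by
  have : (π : ℂ) ≠ 0 := by exact_mod_cast pi_ne_zero
  rw [proj_apply, map_sub, map_smul, circInt_const, smul_eq_mul]
  field_simp
  ring

theorem proj_of_circInt_eq_zero {f : L2} (h : circInt f = 0) : proj f = f := by
  rw [proj_apply, h, map_zero, smul_zero, sub_zero]

theorem inner_constL2 (a : ℂ) (f : L2) :
    inner ℂ (constL2 a) f = starRingEnd ℂ a * circInt f := by
  rw [constL2_eq_smul, inner_smul_left, circInt_eq_inner]

theorem conj_inv_two_pi : starRingEnd ℂ (1 / (2 * π) : ℂ) = (1 / (2 * π) : ℂ) := by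
  have h : (1 / (2 * π) : ℂ) = ((1 / (2 * π) : ℝ) : ℂ) := by push_cast; rfl
  rw [h, Complex.conj_ofReal]

theorem inner_proj_left (f g : L2) : inner ℂ (proj f) g = inner ℂ f (proj g) := by
  have h : inner ℂ f (constL2 (circInt g)) = starRingEnd ℂ (circInt f) * circInt g := by
    rw [← inner_conj_symm, inner_constL2, map_mul, Complex.conj_conj, mul_comm]
  rw [proj_apply, proj_apply, inner_sub_left, inner_sub_right, inner_smul_left, inner_smul_right,
    inner_constL2, h, conj_inv_two_pi]

theorem norm_proj_le (f : L2) : ‖proj f‖ ≤ ‖f‖ := by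
  have h : ‖proj f‖ * ‖proj f‖ ≤ ‖f‖ * ‖proj f‖ := by
    have e : inner ℂ (proj f) (proj f) = inner ℂ f (proj f) := by
      rw [inner_proj_left, proj_of_circInt_eq_zero (circInt_proj f)]
    have e2 := congrArg Complex.re e
    have e3 : (inner ℂ (proj f) (proj f) : ℂ).re = ‖proj f‖ * ‖proj f‖ :=
      inner_self_eq_norm_mul_norm (𝕜 := ℂ) _
    rw [← e3, e2]
    exact re_inner_le_norm (𝕜 := ℂ) _ _
  rcases (norm_nonneg (proj f)).eq_or_lt with h0 | h0
  · rw [← h0]; exact norm_nonneg _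
  · exact le_of_mul_le_mul_right h h0

/-- Cauchy-Schwarz against the constant 1; it supplies the L¹ bound behind the continuity of
`primitive`. -/
theorem integral_norm_le (f : L2) : ∫ x, ‖f x‖ ≤ ‖constL2 1‖ * ‖f‖ := by
  have hm : MemLp (fun x => ((‖f x‖ : ℝ) : ℂ)) 2 (volume : Measure Circ) := (Lp.memLp f).norm.ofReal
  have e : ((∫ x, ‖f x‖ : ℝ) : ℂ) = inner ℂ (constL2 1) (hm.toLp _) := by
    rw [← circInt_eq_inner]
    exact (integral_ofReal (𝕜 := ℂ)).symm.trans (integral_congr_ae hm.coeFn_toLp.symm)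
  have h1 : ‖((∫ x, ‖f x‖ : ℝ) : ℂ)‖ = ∫ x, ‖f x‖ := by
    rw [Complex.norm_real, Real.norm_of_nonneg (integral_nonneg fun x => norm_nonneg _)]
  have h2 : ‖hm.toLp _‖ ≤ ‖f‖ := by
    refine Lp.norm_le_norm_of_ae_le ?_
    filter_upwards [hm.coeFn_toLp] with x hx
    rw [hx, Complex.norm_real, norm_norm]
  rw [← h1, e]
  exact (norm_inner_le_norm _ _).trans (mul_le_mul_of_nonneg_left h2 (norm_nonneg _))

theorem exists_norm_primitive_le : ∃ C, ∀ f : L2, ‖primitive f‖ ≤ C * ‖f‖ := by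
  refine ⟨measureUnivNNReal (volume : Measure Circ) ^ (2 : ENNReal).toReal⁻¹ * ‖constL2 1‖,
    fun f => ?_⟩
  rw [mul_assoc]
  refine Lp.norm_le_of_ae_bound (by positivity) ?_
  filter_upwards [(memLp_primitive f).coeFn_toLp] with x hx
  have e : primitive f = (memLp_primitive f).toLp _ := rfl
  rw [e, hx]
  refine le_trans ?_ (integral_norm_le f)
  have h2 := AddCircle.intervalIntegral_preimage (2 * π) (-π) fun x => ‖f x‖
  rw [show -π + 2 * π = π by ring] at h2
  rw [← h2]
  refine (intervalIntegral.norm_integral_le_integral_norm (rep_mem x).1.le).trans ?_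
  exact intervalIntegral.integral_mono_interval le_rfl (rep_mem x).1.le (rep_mem x).2
    (Filter.Eventually.of_forall fun _ => norm_nonneg _) (f.intervalIntegrable _ _).norm

theorem continuous_primitive : Continuous primitive := by
  obtain ⟨C, hC⟩ := exists_norm_primitive_le
  exact (primitive.mkContinuous C hC).continuous

theorem continuous_circInt : Continuous circInt := by
  simp_rw [funext circInt_eq_inner]
  fun_prop

theorem continuous_constL2 : Continuous constL2 := by
  have h : (fun a : ℂ => a • constL2 1) = constL2 := (funext constL2_eq_smul).symm
  rw [← h]
  fun_prop

theorem continuous_slopeInt : Continuous slopeInt := by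
  simp_rw [funext slopeInt_eq]
  exact continuous_circInt.comp slopeMul.continuous

theorem continuous_proj : Continuous proj := by
  simp_rw [funext proj_apply]
  have h : Continuous fun f => constL2 (circInt f) := continuous_constL2.comp continuous_circInt
  exact continuous_id.sub (h.const_smul (1 / (2 * π) : ℂ))

/-- The bounded part `f ↦ -(1/π) ∮ η_*' f dx + (1/2) Π₀ ∂_x⁻¹ Π₀ f` of the linearized operator. -/
def boundedPart : L2 →L[ℂ] L2 where
  toLinearMap := (1 / 2 : ℂ) • invDeriv - (1 / π : ℂ) • (constL2 ∘ₗ slopeInt)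
  cont := by
    have h1 : Continuous invDeriv :=
      continuous_proj.comp (continuous_primitive.comp continuous_proj)
    have h2 : Continuous fun f => constL2 (slopeInt f) :=
      continuous_constL2.comp continuous_slopeInt
    exact (h1.const_smul (1 / 2 : ℂ)).sub (h2.const_smul (1 / π : ℂ))

theorem boundedPart_apply (f : L2) : boundedPart f =
    (1 / 2 : ℂ) • proj (primitive (proj f)) - (1 / π : ℂ) • constL2 (slopeInt f) := rfl

theorem isSpeedDeriv_speedDeriv (f : dom) : IsSpeedDeriv (f : L2) (speedDeriv f) :=
  f.2.choose_spec

theorem linOp_apply (f : linOp.domain) : linOp f = speedDeriv f + boundedPart (f : L2) := by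
  rw [boundedPart_apply]
  change speedDeriv f - (1 / π : ℂ) • constL2 (slopeInt (f : L2)) +
    (1 / 2 : ℂ) • proj (primitive (proj (f : L2))) = _
  abel

/-- For a primitive P of f, (|P|²)' = 2 Re(conj(f) P), and this integrates to zero because zero mean
makes P periodic. -/
theorem re_inner_primitive {f : L2} (h : circInt f = 0) : (inner ℂ f (primitive f)).re = 0 := by
  have i := f.intervalIntegrable
  set P : ℝ → ℂ := fun y => ∫ t in π..y, f (t : Circ) with hP
  have cP : Continuous P := intervalIntegral.continuous_primitive i π
  have hπ : π ∈ Set.uIcc 0 (2 * π) := by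
    rw [Set.uIcc_of_le Real.two_pi_pos.le]; constructor <;> linarith [pi_pos]
  have hPac : AbsolutelyContinuousOnInterval P 0 (2 * π) :=
    absolutelyContinuousOnInterval_primitive (i _ _) hπ
  have h1 : inner ℂ f (primitive f) =
      ∫ y in (0 : ℝ)..(2 * π), starRingEnd ℂ (f (y : Circ)) * P y := by
    rw [inner_eq]
    refine intervalIntegral_congr_ae ?_
    filter_upwards [primitive_coe h] with y hy
    rw [hy]
  have h2 : inner ℂ (primitive f) f =
      ∫ y in (0 : ℝ)..(2 * π), f (y : Circ) * starRingEnd ℂ (P y) := by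
    rw [inner_eq]
    refine intervalIntegral_congr_ae ?_
    filter_upwards [primitive_coe h] with y hy
    rw [hy, mul_comm]
  have ic : IntervalIntegrable (fun y : ℝ => starRingEnd ℂ (f (y : Circ))) volume 0 (2 * π) :=
    intervalIntegrable_of_integrable (F := fun x => starRingEnd ℂ (f x))
      (Complex.conjCLE.toContinuousLinearMap.integrable_comp (integrable_coe f)) _ _
  have cPc : Continuous fun y => starRingEnd ℂ (P y) := Complex.continuous_conj.comp cP
  have e := AbsolutelyContinuousOnInterval.integral_eq_sub
    (f := fun y => P y * starRingEnd ℂ (P y)) (a := 0) (b := 2 * π)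
    (f' := fun y => f (y : Circ) * starRingEnd ℂ (P y) + starRingEnd ℂ (f (y : Circ)) * P y)
    (hPac.fun_smul hPac.conj)
    (((i _ _).mul_continuousOn cPc.continuousOn).add (ic.mul_continuousOn cP.continuousOn)) (by
      filter_upwards [(i 0 (2 * π)).ae_hasDerivAt_integral] with y hy hm
      have d := hy hm π hπ
      exact (d.mul d.star).congr_deriv (by simp only [starRingEnd_apply]; ring))
  rw [intervalIntegral.integral_add ((i _ _).mul_continuousOn cPc.continuousOn)
    (ic.mul_continuousOn cP.continuousOn), ← h1, ← h2] at e
  have e4 : P (2 * π) = P 0 := by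
    have hz : ∫ t in (0 : ℝ)..(2 * π), f (t : Circ) = 0 := (integral_circ f).symm.trans h
    simp only [hP]
    rw [← intervalIntegral.integral_add_adjacent_intervals (i π 0) (i 0 (2 * π)), hz, add_zero]
  rw [e4, sub_self, ← inner_conj_symm] at e
  have hr := congrArg Complex.re e
  simp only [Complex.add_re, Complex.conj_re, Complex.zero_re] at hr
  linarith

/-- Expand the form of η_*' at Π₀f = f - c/2π, where c = ∮ f and s = ∮ η_*' f. The square of the
constant drops out since ∮ η_*' = 0, and the cross terms give -(1/π) Re(conj(c) s), which is the
contribution of the rank-one term of A. The primitive term contributes nothing. -/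
theorem re_inner_boundedPart (f : L2) :
    (inner ℂ f (boundedPart f)).re + (inner ℂ f (slopeMul f)).re =
      (inner ℂ (proj f) (slopeMul (proj f))).re := by
  have hπ : (π : ℂ) ≠ 0 := by exact_mod_cast pi_ne_zero
  set c := circInt f with hc
  set s := slopeInt f with hs
  have h1 : (inner ℂ f (proj (primitive (proj f)))).re = 0 := by
    rw [← inner_proj_left]
    exact re_inner_primitive (circInt_proj f)
  have h2 : inner ℂ f (constL2 s) = starRingEnd ℂ c * s := by
    rw [← inner_conj_symm, inner_constL2, map_mul, Complex.conj_conj, mul_comm]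
  have h3 : ∀ a : ℂ, inner ℂ (constL2 a) (slopeMul f) = starRingEnd ℂ a * s := fun a => by
    rw [inner_constL2, ← slopeInt_eq]
  have h4 : ∀ a : ℂ, inner ℂ f (slopeMul (constL2 a)) = a * starRingEnd ℂ s := fun a => by
    rw [← inner_slopeMul, ← inner_conj_symm, h3, map_mul, Complex.conj_conj]
  have h5 : inner ℂ (constL2 c) (slopeMul (constL2 c)) = 0 := by
    rw [inner_constL2, ← slopeInt_eq, slopeInt_const, mul_zero]
  have h6 : inner ℂ (proj f) (slopeMul (proj f)) = inner ℂ f (slopeMul f) -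
      1 / (2 * π) * (c * starRingEnd ℂ s) - 1 / (2 * π) * (starRingEnd ℂ c * s) := by
    rw [proj_apply f, map_sub, map_smul]
    simp only [inner_sub_left, inner_sub_right, inner_smul_left, inner_smul_right, h3, h4, h5,
      ← hc, conj_inv_two_pi]
    ring
  have h7 : inner ℂ f (boundedPart f) = 1 / 2 * inner ℂ f (proj (primitive (proj f))) -
      1 / π * (starRingEnd ℂ c * s) := by
    rw [boundedPart_apply, inner_sub_right, inner_smul_right, inner_smul_right, ← hs, h2]
  have h8 : (c * starRingEnd ℂ s).re = (starRingEnd ℂ c * s).re := by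
    simp [Complex.mul_re]
  have h9 : ∀ z : ℂ, (1 / (2 * π) * z : ℂ).re = 1 / (2 * π) * z.re := fun z => by
    rw [← Complex.re_ofReal_mul]; push_cast; rfl
  have h10 : ∀ z : ℂ, (1 / π * z : ℂ).re = 1 / π * z.re := fun z => by
    rw [← Complex.re_ofReal_mul]; push_cast; rfl
  have h11 : ((1 / 2 : ℂ) * inner ℂ f (proj (primitive (proj f)))).re = 0 := by
    rw [Complex.mul_re, h1]; norm_num
  rw [h6, h7]
  simp only [Complex.sub_re, h9, h10, h8, h11]
  field_simp
  ring

/-- The value π/4 is only approached at the peak, where the slope itself is 0 by the convention for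
the sign. Strictness is what excludes eigenvalues on the boundary lines. -/
theorem abs_peakSlope_lt (x : Circ) : |peakSlope x| < π / 4 := by
  have hx : |rep x| ≤ π := abs_le.2 ⟨(rep_mem x).1.le, (rep_mem x).2⟩
  rw [peakSlope]
  rcases eq_or_ne (rep x) 0 with h0 | h0
  · rw [h0, Real.sign_zero, mul_zero, abs_zero]
    positivity
  · have hx0 := abs_pos.2 h0
    rcases Real.sign_apply_eq (rep x) with h | h | h <;> rw [h, abs_lt] <;>
      constructor <;> linarith [pi_pos]

theorem abs_re_inner_slopeMul_lt {f : L2} (hf : f ≠ 0) :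
    |(inner ℂ f (slopeMul f)).re| < π / 4 * ‖f‖ ^ 2 := by
  have h1 : (inner ℂ f (slopeMul f)).re = ∫ x, peakSlope x * ‖f x‖ ^ 2 := by
    rw [L2.inner_def]
    refine (integral_re (𝕜 := ℂ) (L2.integrable_inner (𝕜 := ℂ) f (slopeMul f))).symm.trans ?_
    refine integral_congr_ae ?_
    filter_upwards [mulOp_coeFn measurable_peakSlope abs_peakSlope_le f] with x hx
    rw [slopeMul, hx, RCLike.inner_apply', mul_left_comm, Complex.conj_mul',
      RCLike.re_eq_complex_re, Complex.re_ofReal_mul]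
    norm_cast
  have h2 : ‖f‖ ^ 2 = ∫ x, ‖f x‖ ^ 2 := by
    rw [← inner_self_eq_norm_sq (𝕜 := ℂ), L2.inner_def]
    refine (integral_re (𝕜 := ℂ) (L2.integrable_inner (𝕜 := ℂ) f f)).symm.trans ?_
    exact integral_congr_ae (Filter.Eventually.of_forall fun x => inner_self_eq_norm_sq _)
  have i2 : Integrable fun x => ‖f x‖ ^ 2 := (Lp.memLp f).integrable_norm_pow (by norm_num)
  have i1 : Integrable fun x => peakSlope x * ‖f x‖ ^ 2 :=
    i2.bdd_mul measurable_peakSlope.aestronglyMeasurable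
      (Filter.Eventually.of_forall fun x => abs_peakSlope_le x)
  -- The integrand (π/4 + s η_*')|f|² has a strictly positive weight, so its integral vanishes only
  -- for f = 0. The values s = 1 and s = -1 give the two sides.
  have key : ∀ s : ℝ, |s| ≤ 1 → 0 < π / 4 * ‖f‖ ^ 2 + s * (inner ℂ f (slopeMul f)).re := by
    intro s hs
    have hpos : ∀ x, 0 < π / 4 + s * peakSlope x := fun x => by
      have h3 := abs_peakSlope_lt x
      have h4 : |s * peakSlope x| < π / 4 := by
        rw [abs_mul]
        exact (mul_le_of_le_one_left (abs_nonneg _) hs).trans_lt h3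
      linarith [(abs_lt.1 h4).1]
    have e : π / 4 * ‖f‖ ^ 2 + s * (inner ℂ f (slopeMul f)).re =
        ∫ x, (π / 4 + s * peakSlope x) * ‖f x‖ ^ 2 := by
      rw [h1, h2, ← integral_const_mul, ← integral_const_mul,
        ← integral_add (i2.const_mul _) (i1.const_mul _)]
      refine integral_congr_ae (Filter.Eventually.of_forall fun x => ?_)
      ring
    have i3 : Integrable fun x => (π / 4 + s * peakSlope x) * ‖f x‖ ^ 2 := by
      refine ((i2.const_mul (π / 4)).add (i1.const_mul s)).congr
        (Filter.Eventually.of_forall fun x => ?_)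
      simp only [Pi.add_apply]
      ring
    have hnn : ∀ x, 0 ≤ (π / 4 + s * peakSlope x) * ‖f x‖ ^ 2 := fun x =>
      mul_nonneg (hpos x).le (sq_nonneg _)
    rw [e]
    refine lt_of_le_of_ne (integral_nonneg hnn) fun h0 => hf ?_
    have h3 := (integral_eq_zero_iff_of_nonneg hnn i3).1 h0.symm
    refine (Lp.eq_zero_iff_ae_eq_zero).2 ?_
    filter_upwards [h3] with x hx
    rcases mul_eq_zero.1 hx with h4 | h4
    · exact absurd h4 (hpos x).ne'
    · exact norm_eq_zero.1 (pow_eq_zero_iff two_ne_zero |>.1 h4)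
  rw [abs_lt]
  have k1 := key 1 (by norm_num)
  have k2 := key (-1) (by norm_num)
  constructor <;> linarith

/-- The quadratic form of the linearized operator is bounded by `π / 4`. -/
theorem abs_re_inner_boundedPart_add_lt {f : L2} (hf : f ≠ 0) :
    |(inner ℂ f (boundedPart f)).re + (inner ℂ f (slopeMul f)).re| < π / 4 * ‖f‖ ^ 2 := by
  have hf' := norm_pos_iff.2 hf
  rw [re_inner_boundedPart]
  rcases eq_or_ne (proj f) 0 with h | h
  · rw [h, inner_zero_left, Complex.zero_re, abs_zero]
    positivity
  · refine (abs_re_inner_slopeMul_lt h).trans_le ?_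
    gcongr
    exact norm_proj_le f

/-! ### The resolvent set -/

/-- `speedDeriv` is defined by choice; uniqueness of the weak derivative lets an explicit g take its
place. -/
theorem IsSpeedDeriv.exists_linOp {f g : L2} (h : IsSpeedDeriv f g) :
    ∃ F : linOp.domain, (F : L2) = f ∧ linOp F = g + boundedPart f := by
  have hm : f ∈ linOp.domain := ⟨g, h⟩
  exact ⟨⟨f, hm⟩, rfl, (linOp_apply ⟨f, hm⟩).trans
    (congrArg (· + boundedPart f) ((isSpeedDeriv_speedDeriv ⟨f, hm⟩).unique h))⟩

theorem re_inner_linOp (f : linOp.domain) : (inner ℂ (f : L2) (linOp f)).re =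
    (inner ℂ (f : L2) (boundedPart f)).re + (inner ℂ (f : L2) (slopeMul f)).re := by
  rw [linOp_apply, inner_add_right, Complex.add_re, (isSpeedDeriv_speedDeriv f).re_inner, add_comm]

theorem re_inner_smul_self (z : ℂ) (f : L2) : (inner ℂ f (z • f)).re = z.re * ‖f‖ ^ 2 := by
  have h : inner ℂ f f = ((‖f‖ ^ 2 : ℝ) : ℂ) := by
    rw [inner_self_eq_norm_sq_to_K, Complex.ofReal_pow]
    rfl
  rw [inner_smul_right, h, Complex.re_mul_ofReal]

theorem abs_re_inner_linOp_le (f : linOp.domain) :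
    |(inner ℂ (f : L2) (linOp f)).re| ≤ π / 4 * ‖(f : L2)‖ ^ 2 := by
  rcases eq_or_ne (f : L2) 0 with h | h
  · rw [h, inner_zero_left, Complex.zero_re, abs_zero]
    positivity
  · rw [re_inner_linOp]
    exact (abs_re_inner_boundedPart_add_lt h).le

theorem abs_re_lt_of_mem_pointSpec {z : ℂ} (hz : z ∈ pointSpec linOp) : |z.re| < π / 4 := by
  obtain ⟨f, hf, he⟩ := hz
  have hf' : (f : L2) ≠ 0 := fun h => hf (Subtype.ext h)
  have h := abs_re_inner_boundedPart_add_lt hf'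
  rw [← re_inner_linOp, he, re_inner_smul_self, abs_mul, abs_of_nonneg (sq_nonneg ‖(f : L2)‖)] at h
  exact lt_of_mul_lt_mul_right h (sq_nonneg _)

/-- Cauchy-Schwarz applied to Re⟨f, (A - z)f⟩, whose modulus is at least (|Re z| - π/4)‖f‖². Both
half-planes are covered because the form of A is bounded on both sides. -/
theorem norm_linOp_sub_ge (z : ℂ) (f : linOp.domain) :
    (|z.re| - π / 4) * ‖(f : L2)‖ ≤ ‖linOp f - z • (f : L2)‖ := by
  rcases (norm_nonneg (f : L2)).eq_or_lt with h0 | h0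
  · rw [← h0, mul_zero]
    exact norm_nonneg _
  refine le_of_mul_le_mul_left ?_ h0
  refine le_trans ?_ ((Complex.abs_re_le_norm _).trans
    (norm_inner_le_norm (𝕜 := ℂ) (f : L2) (linOp f - z • (f : L2))))
  rw [inner_sub_right, Complex.sub_re, re_inner_smul_self]
  have h1 := abs_re_inner_linOp_le f
  have h2 := abs_sub_abs_le_abs_sub (z.re * ‖(f : L2)‖ ^ 2) (inner ℂ (f : L2) (linOp f)).re
  rw [abs_mul, abs_of_nonneg (sq_nonneg ‖(f : L2)‖), abs_sub_comm] at h2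
  nlinarith

/-- The operator `A - z` on the domain. -/
def shifted (z : ℂ) : linOp.domain →ₗ[ℂ] L2 := linOp.toFun - z • linOp.domain.subtype

theorem shifted_apply (z : ℂ) (f : linOp.domain) : shifted z f = linOp f - z • (f : L2) := rfl

/-- The lower bound makes preimages of a convergent sequence Cauchy, and closedness of the
differential part identifies the image of their limit. -/
theorem isClosed_range_shifted {z : ℂ} (hz : π / 4 < |z.re|) :
    IsClosed ((shifted z).range : Set L2) := by
  refine IsSeqClosed.isClosed fun u g hu hug => ?_
  choose f hf using hu
  have hδ : 0 < |z.re| - π / 4 := sub_pos.2 hz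
  have hc : CauchySeq fun n => (f n : L2) := by
    rw [Metric.cauchySeq_iff']
    intro ε hε
    obtain ⟨N, hN⟩ := Metric.cauchySeq_iff'.1 hug.cauchySeq ((|z.re| - π / 4) * ε) (by positivity)
    refine ⟨N, fun n hn => ?_⟩
    have h1 := hN n hn
    have h2 := norm_linOp_sub_ge z (f n - f N)
    rw [← shifted_apply, map_sub, hf, hf, ← dist_eq_norm, Submodule.coe_sub, ← dist_eq_norm] at h2
    exact lt_of_mul_lt_mul_left (h2.trans_lt h1) hδ.le
  obtain ⟨f₀, hf₀⟩ := cauchySeq_tendsto_of_complete hc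
  have hs : ∀ n, IsSpeedDeriv (f n : L2) (u n + z • (f n : L2) - boundedPart (f n)) := fun n => by
    have e : u n + z • (f n : L2) - boundedPart (f n) = speedDeriv (f n) := by
      rw [← hf n, shifted_apply, linOp_apply]
      abel
    rw [e]
    exact isSpeedDeriv_speedDeriv (f n)
  have h0 : IsSpeedDeriv f₀ (g + z • f₀ - boundedPart f₀) :=
    IsSpeedDeriv.of_tendsto hs hf₀
      ((hug.add (hf₀.const_smul z)).sub ((boundedPart.continuous.tendsto f₀).comp hf₀))
  obtain ⟨F, hF, he⟩ := h0.exists_linOp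
  refine ⟨F, ?_⟩
  rw [shifted_apply, he, hF]
  abel

/-- If u is orthogonal to the range, testing on smooth functions shows that w u' exists in L² and
equals B*u - conj(z) u - w'u, where B is `boundedPart`. The energy identity for u then gives Re⟨u,
Bu⟩ + ∮ η_*'|u|² = Re z ‖u‖², contradicting the bound π/4 on this form unless u = 0. -/
theorem orthogonal_range_shifted {z : ℂ} (hz : π / 4 < |z.re|) : (shifted z).rangeᗮ = ⊥ := by
  rw [Submodule.eq_bot_iff]
  intro u hu
  by_contra hne
  have hd : IsSpeedDeriv u (ContinuousLinearMap.adjoint boundedPart u - (starRingEnd ℂ z) • u +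
      (2 : ℂ) • slopeMul u) := by
    rw [isSpeedDeriv_iff_inner]
    intro φ hφ _
    have h1 := isSpeedDeriv_ofFun hφ
    set F := ofFun φ hφ.continuous
    set G := ofFun (deriv φ) (hφ.continuous_deriv (by simp))
    obtain ⟨F', hF', he⟩ := h1.exists_linOp
    have h2 := hu (shifted z F') ⟨_, rfl⟩
    rw [shifted_apply, he, hF'] at h2
    simp only [inner_sub_left, inner_add_left, inner_smul_left] at h2
    simp only [inner_add_right, inner_sub_right, inner_smul_right, inner_sub_left, inner_smul_left,
      ContinuousLinearMap.adjoint_inner_right, inner_slopeMul, map_ofNat]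
    linear_combination h2
  have h3 := hd.re_inner
  simp only [inner_add_right, inner_sub_right, ContinuousLinearMap.adjoint_inner_right,
    Complex.add_re, Complex.sub_re, re_inner_smul_self, Complex.conj_re] at h3
  have h4 : (inner ℂ u ((2 : ℂ) • slopeMul u)).re = 2 * (inner ℂ u (slopeMul u)).re := by
    rw [inner_smul_right, Complex.mul_re]
    simp
  have h5 : (inner ℂ (boundedPart u) u).re = (inner ℂ u (boundedPart u)).re := by
    rw [← inner_conj_symm, Complex.conj_re]
  have h6 := abs_re_inner_boundedPart_add_lt hne
  rw [h4, h5] at h3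
  have h7 : (inner ℂ u (boundedPart u)).re + (inner ℂ u (slopeMul u)).re = z.re * ‖u‖ ^ 2 := by
    linarith
  rw [h7, abs_mul, abs_of_nonneg (sq_nonneg ‖u‖)] at h6
  exact lt_asymm hz (lt_of_mul_lt_mul_right h6 (sq_nonneg _))

theorem mem_resolventSet_of_lt {z : ℂ} (hz : π / 4 < |z.re|) : z ∈ resolventSet linOp := by
  have hδ : 0 < |z.re| - π / 4 := sub_pos.2 hz
  have hinj : Function.Injective (shifted z) := by
    rw [← LinearMap.ker_eq_bot, LinearMap.ker_eq_bot']
    intro f hf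
    have h := norm_linOp_sub_ge z f
    rw [← shifted_apply, hf, norm_zero] at h
    have h2 : ‖(f : L2)‖ = 0 :=
      le_antisymm (nonpos_of_mul_nonpos_right h hδ) (norm_nonneg _)
    exact Subtype.ext (norm_eq_zero.1 h2)
  have hsurj : Function.Surjective (shifted z) := by
    have := (isClosed_range_shifted hz).completeSpace_coe
    rw [← LinearMap.range_eq_top]
    exact Submodule.orthogonal_eq_bot_iff.1 (orthogonal_range_shifted hz)
  let e := LinearEquiv.ofBijective (shifted z) ⟨hinj, hsurj⟩
  have he : ∀ g, shifted z (e.symm g) = g := fun g => e.apply_symm_apply g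
  refine ⟨(linOp.domain.subtype ∘ₗ e.symm.toLinearMap).mkContinuous (|z.re| - π / 4)⁻¹ fun g => ?_,
    fun g => ⟨e.symm g, rfl, he g⟩, fun f => ?_⟩
  · have h := norm_linOp_sub_ge z (e.symm g)
    rw [← shifted_apply, he] at h
    rw [inv_mul_eq_div, le_div_iff₀ hδ, mul_comm]
    exact h
  · exact congrArg Subtype.val (e.symm_apply_apply f)

/-- For an eigenvector f at z', R((z' - z)f) = f, so eigenvalues stay at distance at least 1/‖R‖
from z. -/
theorem one_le_of_mem_pointSpec {H : Type*} [NormedAddCommGroup H] [NormedSpace ℂ H]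
    {T : H →ₗ.[ℂ] H} {z : ℂ} {R : H →L[ℂ] H} (hR : ∀ f : T.domain, R (T f - z • (f : H)) = f)
    {z' : ℂ} (hz' : z' ∈ pointSpec T) : 1 ≤ ‖R‖ * ‖z' - z‖ := by
  obtain ⟨f, hf, he⟩ := hz'
  have hf' : 0 < ‖(f : H)‖ := norm_pos_iff.2 fun h => hf (Subtype.ext h)
  have h := hR f
  rw [he, ← sub_smul] at h
  have h2 := R.le_opNorm ((z' - z) • (f : H))
  rw [h, norm_smul, ← mul_assoc] at h2
  exact le_of_mul_le_mul_right (by rwa [one_mul]) hf'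

/-! ### The eigenfunctions -/

theorem IsSpeedDeriv.circInt_eq {f g : L2} (h : IsSpeedDeriv f g) : circInt g = 2 * slopeInt f := by
  have e := isSpeedDeriv_iff_coord.1 h (fun _ => 1) contDiff_const (fun _ => rfl)
  have e1 : circInt g = ∫ y in (0 : ℝ)..(2 * π), g (y : Circ) := integral_circ g
  have e2 : slopeInt f = ∫ y in (0 : ℝ)..(2 * π), slopeMul f (y : Circ) := by
    rw [slopeInt_eq]
    exact integral_circ (slopeMul f)
  simp only [deriv_const, mul_one, mul_zero, add_zero] at e
  rw [e1, e, e2, ← intervalIntegral.integral_const_mul, ← intervalIntegral.integral_neg]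
  refine intervalIntegral_congr_ae ?_
  filter_upwards [slopeMul_coe f] with y hy
  rw [hy]
  push_cast
  ring

/-- The mean of w f' is 2∮ η_*' f, and the rank-one term cancels exactly this. -/
theorem circInt_linOp (f : linOp.domain) : circInt (linOp f) = 0 := by
  have hπ : (π : ℂ) ≠ 0 := by exact_mod_cast pi_ne_zero
  rw [linOp_apply, boundedPart_apply, map_add, map_sub, map_smul, map_smul, circInt_proj,
    circInt_const, (isSpeedDeriv_speedDeriv f).circInt_eq, smul_zero, smul_eq_mul]
  field_simp
  ring

/-- The function `t ^ (1 + μ) (1 - t) ^ (1 - μ)`, where `t = y / 2π`. -/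
def eigPrim (μ : ℂ) (y : ℝ) : ℂ :=
  ((y / (2 * π) : ℝ) : ℂ) ^ (1 + μ) * ((1 - y / (2 * π) : ℝ) : ℂ) ^ (1 - μ)

/-- The function `t ^ μ (1 - t) ^ (-μ) (1 + μ - 2 t)`, where `t = y / 2π`; it is the derivative of
`eigPrim μ` with respect to `t`. -/
def eigFun (μ : ℂ) (y : ℝ) : ℂ :=
  ((y / (2 * π) : ℝ) : ℂ) ^ μ * ((1 - y / (2 * π) : ℝ) : ℂ) ^ (-μ) * (1 + μ - y / π)

theorem re_pos_of_abs_re_lt {μ : ℂ} (hμ : |μ.re| < 1 / 2) : 0 < (1 + μ).re ∧ 0 < (1 - μ).re := by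
  have h := abs_lt.1 hμ
  rw [Complex.add_re, Complex.sub_re, Complex.one_re]
  constructor <;> linarith [h.1, h.2]

theorem continuous_eigPrim {μ : ℂ} (hμ : |μ.re| < 1 / 2) : Continuous (eigPrim μ) :=
  ((Complex.continuous_ofReal_cpow_const (re_pos_of_abs_re_lt hμ).1).comp (by fun_prop)).mul
    ((Complex.continuous_ofReal_cpow_const (re_pos_of_abs_re_lt hμ).2).comp (by fun_prop))

theorem eigPrim_zero {μ : ℂ} (hμ : |μ.re| < 1 / 2) : eigPrim μ 0 = 0 := by
  have h : 1 + μ ≠ 0 := fun h => (re_pos_of_abs_re_lt hμ).1.ne' (by rw [h, Complex.zero_re])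
  simp [eigPrim, h]

theorem eigPrim_two_pi {μ : ℂ} (hμ : |μ.re| < 1 / 2) : eigPrim μ (2 * π) = 0 := by
  have h : 1 - μ ≠ 0 := fun h => (re_pos_of_abs_re_lt hμ).2.ne' (by rw [h, Complex.zero_re])
  simp [eigPrim, h]

theorem eigPrim_pi_ne_zero (μ : ℂ) : eigPrim μ π ≠ 0 := by
  have h : π / (2 * π) = 1 / 2 := by have := pi_ne_zero; field_simp
  rw [eigPrim, h]
  refine mul_ne_zero ?_ ?_ <;>
  · rw [Complex.cpow_ne_zero_iff]
    left
    norm_num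

theorem measurable_eigFun (μ : ℂ) : Measurable (eigFun μ) := by
  have h1 : Measurable fun y : ℝ => ((y / (2 * π) : ℝ) : ℂ) := by fun_prop
  have h2 : Measurable fun y : ℝ => ((1 - y / (2 * π) : ℝ) : ℂ) := by fun_prop
  have h3 : Measurable fun y : ℝ => (1 + μ - y / π : ℂ) := by fun_prop
  exact ((h1.pow_const μ).mul (h2.pow_const (-μ))).mul h3

theorem div_two_pi_mem {y : ℝ} (hy : y ∈ Set.Ioo 0 (2 * π)) :
    0 < y / (2 * π) ∧ 0 < 1 - y / (2 * π) := by
  refine ⟨div_pos hy.1 Real.two_pi_pos, ?_⟩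
  rw [sub_pos, div_lt_one Real.two_pi_pos]
  exact hy.2

/-- Since w = π² t(1 - t), multiplication by w raises both exponents by one. The product thus
extends continuously by zero to the peak even where `eigFun μ` is unbounded. -/
theorem speed_mul_eigFun (μ : ℂ) {y : ℝ} (hy : y ∈ Set.Ioo 0 (2 * π)) :
    ((y * (2 * π - y) / 4 : ℝ) : ℂ) * eigFun μ y = π ^ 2 * eigPrim μ y * (1 + μ - y / π) := by
  have h := div_two_pi_mem hy
  have h1 : ((y / (2 * π) : ℝ) : ℂ) ≠ 0 := Complex.ofReal_ne_zero.2 h.1.ne'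
  have h2 : ((1 - y / (2 * π) : ℝ) : ℂ) ≠ 0 := Complex.ofReal_ne_zero.2 h.2.ne'
  have h3 : (y * (2 * π - y) / 4 : ℝ) = π ^ 2 * (y / (2 * π)) * (1 - y / (2 * π)) := by
    have := pi_ne_zero
    field_simp
    ring
  rw [eigFun, eigPrim, Complex.cpow_add _ _ h1, sub_eq_add_neg 1 μ, Complex.cpow_add _ _ h2,
    Complex.cpow_one, Complex.cpow_one, h3, Complex.ofReal_mul, Complex.ofReal_mul,
    Complex.ofReal_pow]
  ring

theorem hasDerivAt_eigPrim (μ : ℂ) {y : ℝ} (hy : y ∈ Set.Ioo 0 (2 * π)) :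
    HasDerivAt (eigPrim μ) (eigFun μ y / (2 * π)) y := by
  have h := div_two_pi_mem hy
  have h1 : ((y / (2 * π) : ℝ) : ℂ) ≠ 0 := Complex.ofReal_ne_zero.2 h.1.ne'
  have h2 : ((1 - y / (2 * π) : ℝ) : ℂ) ≠ 0 := Complex.ofReal_ne_zero.2 h.2.ne'
  have e1 : ((y / (2 * π) : ℝ) : ℂ) = (y : ℂ) / (2 * π) := by push_cast; rfl
  have e2 : ((1 - y / (2 * π) : ℝ) : ℂ) = 1 - (y : ℂ) / (2 * π) := by push_cast; rfl
  have d1 : HasDerivAt (fun z : ℂ => z / (2 * π)) (1 / (2 * π)) (y : ℂ) :=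
    (hasDerivAt_id _).div_const _
  have d3 := (d1.cpow_const (c := 1 + μ)
    (by rw [← e1]; exact Complex.ofReal_mem_slitPlane.2 h.1)).mul
    ((d1.const_sub 1).cpow_const (c := 1 - μ)
    (by rw [← e2]; exact Complex.ofReal_mem_slitPlane.2 h.2))
  have d4 := d3.comp_ofReal
  refine (d4.congr_of_eventuallyEq (Filter.Eventually.of_forall fun z => ?_)).congr_deriv ?_
  · simp only [eigPrim, Pi.mul_apply]
    push_cast
    rfl
  · rw [← e2, ← e1, eigFun, add_sub_cancel_left, show 1 - μ - 1 = -μ by ring,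
      Complex.cpow_add _ _ h1, sub_eq_add_neg 1 μ, Complex.cpow_add _ _ h2,
      Complex.cpow_one, Complex.cpow_one]
    have hπ : (π : ℂ) ≠ 0 := by exact_mod_cast pi_ne_zero
    push_cast
    field_simp
    ring

/-- The square of the modulus is at most (3 + |μ|)² t^(2 Re μ) (1 - t)^(-2 Re μ), a Beta integrand
with parameters 1 ± 2 Re μ, both positive under the hypothesis. -/
theorem memLp_eigFun {μ : ℂ} (hμ : |μ.re| < 1 / 2) :
    MemLp (fun x : Circ => eigFun μ (ang x)) 2 volume := by
  have hm : Measurable fun x : Circ => eigFun μ (ang x) := (measurable_eigFun μ).comp measurable_ang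
  rw [memLp_two_iff_integrable_sq_norm hm.aestronglyMeasurable]
  have h := abs_lt.1 hμ
  have hb := (Complex.betaIntegral_convergent (u := ((1 + 2 * μ.re : ℝ) : ℂ))
    (v := ((1 - 2 * μ.re : ℝ) : ℂ)) (by rw [Complex.ofReal_re]; linarith [h.1])
    (by rw [Complex.ofReal_re]; linarith [h.2])).comp_mul_left (c := (2 * π)⁻¹)
  rw [zero_div, one_div, inv_inv, intervalIntegrable_iff_integrableOn_Ioc_of_le
    Real.two_pi_pos.le] at hb
  have hb2 : IntegrableOn (fun y : ℝ => ‖eigFun μ y‖ ^ 2) (Set.Ioc 0 (2 * π)) := by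
    refine (hb.norm.const_mul ((3 + ‖μ‖) ^ 2)).mono'
      ((measurable_eigFun μ).norm.pow_const 2).aestronglyMeasurable ?_
    filter_upwards [ae_mem_Ioo] with y hy
    have ht := div_two_pi_mem hy
    have e1 : (2 * π)⁻¹ * y = y / (2 * π) := by rw [div_eq_inv_mul]
    have e2 : (1 - ((y / (2 * π) : ℝ) : ℂ)) = ((1 - y / (2 * π) : ℝ) : ℂ) := by push_cast; rfl
    have e3 : ‖(1 + μ - y / π : ℂ)‖ ≤ 3 + ‖μ‖ := by
      have h1 : ‖(y / π : ℂ)‖ ≤ 2 := by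
        rw [← Complex.ofReal_div, Complex.norm_real, Real.norm_of_nonneg (by
          have := hy.1; positivity), div_le_iff₀ pi_pos]
        exact hy.2.le
      calc ‖(1 + μ - y / π : ℂ)‖ ≤ ‖(1 + μ : ℂ)‖ + ‖(y / π : ℂ)‖ := norm_sub_le _ _
        _ ≤ (1 + ‖μ‖) + 2 := by
          gcongr
          exact (norm_add_le _ _).trans_eq (by rw [norm_one])
        _ = 3 + ‖μ‖ := by ring
    rw [Real.norm_of_nonneg (sq_nonneg _), e1, e2, eigFun, norm_mul, norm_mul, norm_mul,
      Complex.norm_cpow_eq_rpow_re_of_pos ht.1, Complex.norm_cpow_eq_rpow_re_of_pos ht.2,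
      Complex.norm_cpow_eq_rpow_re_of_pos ht.1, Complex.norm_cpow_eq_rpow_re_of_pos ht.2,
      mul_pow, mul_pow, ← Real.rpow_mul_natCast ht.1.le, ← Real.rpow_mul_natCast ht.2.le]
    have e4 : (((1 + 2 * μ.re : ℝ) : ℂ) - 1).re = μ.re * (2 : ℕ) := by
      rw [Complex.sub_re, Complex.ofReal_re, Complex.one_re]; push_cast; ring
    have e5 : (((1 - 2 * μ.re : ℝ) : ℂ) - 1).re = (-μ).re * (2 : ℕ) := by
      rw [Complex.sub_re, Complex.ofReal_re, Complex.one_re, Complex.neg_re]; push_cast; ring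
    rw [e4, e5, mul_comm]
    have h5 := Real.rpow_nonneg ht.1.le (μ.re * (2 : ℕ))
    have h6 := Real.rpow_nonneg ht.2.le ((-μ).re * (2 : ℕ))
    gcongr
  exact (measurePreserving_ang.integrable_comp
    ((measurable_eigFun μ).norm.pow_const 2).aestronglyMeasurable).2 hb2

/-- The function `eigFun μ` as an element of `L²(𝕋)`. -/
def eigL2 {μ : ℂ} (hμ : |μ.re| < 1 / 2) : L2 := (memLp_eigFun hμ).toLp _

theorem eigL2_coe {μ : ℂ} (hμ : |μ.re| < 1 / 2) :
    ∀ᵐ y : ℝ ∂(volume.restrict (Set.Ioc 0 (2 * π))), eigL2 hμ (y : Circ) = eigFun μ y := by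
  filter_upwards [ae_coe (memLp_eigFun hμ).coeFn_toLp, ae_restrict_mem measurableSet_Ioc]
    with y h hy
  rw [eigL2, h, ang_coe hy]

theorem intervalIntegral_eigL2 {μ : ℂ} (hμ : |μ.re| < 1 / 2) {a b : ℝ} (ha : 0 ≤ a) (hab : a ≤ b)
    (hb : b ≤ 2 * π) :
    ∫ y in a..b, eigL2 hμ (y : Circ) = 2 * π * (eigPrim μ b - eigPrim μ a) := by
  have hπ : (π : ℂ) ≠ 0 := by exact_mod_cast pi_ne_zero
  have hae : ∀ᵐ y : ℝ ∂(volume.restrict (Set.uIoc a b)), eigL2 hμ (y : Circ) = eigFun μ y := by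
    rw [Set.uIoc_of_le hab]
    exact ae_restrict_of_ae_restrict_of_subset (Set.Ioc_subset_Ioc ha hb) (eigL2_coe hμ)
  rw [intervalIntegral.integral_congr_ae_restrict hae,
    intervalIntegral.integral_eq_sub_of_hasDerivAt_of_le
    (f := fun y => 2 * π * eigPrim μ y) hab
    (continuous_const.mul (continuous_eigPrim hμ)).continuousOn (fun y hy => ?_)
    (((eigL2 hμ).intervalIntegrable a b).congr_ae hae)]
  · ring
  · refine ((hasDerivAt_eigPrim μ ⟨ha.trans_lt hy.1, hy.2.trans_le hb⟩).const_mul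
      (2 * π : ℂ)).congr_deriv ?_
    field_simp

theorem circInt_eigL2 {μ : ℂ} (hμ : |μ.re| < 1 / 2) : circInt (eigL2 hμ) = 0 := by
  refine (integral_circ _).trans ?_
  rw [intervalIntegral_eigL2 hμ le_rfl Real.two_pi_pos.le le_rfl, eigPrim_zero hμ,
    eigPrim_two_pi hμ, sub_self, mul_zero]

/-- Its integral over (0, π) is 2π `eigPrim μ π`, which is not zero. -/
theorem eigL2_ne_zero {μ : ℂ} (hμ : |μ.re| < 1 / 2) : eigL2 hμ ≠ 0 := by
  intro h0
  have h1 := intervalIntegral_eigL2 hμ le_rfl pi_pos.le (by linarith [pi_pos])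
  have h2 : ∫ y in (0 : ℝ)..π, eigL2 hμ (y : Circ) = 0 := by
    rw [h0]
    refine (intervalIntegral.integral_congr_ae_restrict (g := fun _ => (0 : ℂ)) ?_).trans
      intervalIntegral.integral_zero
    rw [Set.uIoc_of_le pi_pos.le]
    exact ae_restrict_of_ae_restrict_of_subset
      (Set.Ioc_subset_Ioc_right (by linarith [pi_pos] : π ≤ 2 * π))
      (ae_coe (Lp.coeFn_zero ℂ 2 (volume : Measure Circ)))
  have hπ : (π : ℂ) ≠ 0 := by exact_mod_cast pi_ne_zero
  rw [h2, eigPrim_zero hμ, sub_zero] at h1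
  exact mul_ne_zero (mul_ne_zero two_ne_zero hπ) (eigPrim_pi_ne_zero μ) h1.symm

theorem primitive_eigL2 {μ : ℂ} (hμ : |μ.re| < 1 / 2) : primitive (eigL2 hμ) =
    (2 * π : ℂ) • ofFun (eigPrim μ) (continuous_eigPrim hμ) -
      constL2 (2 * π * eigPrim μ π) := by
  refine L2.ext_coe ?_
  filter_upwards [primitive_coe (circInt_eigL2 hμ), ofFun_coe (continuous_eigPrim hμ),
    ae_coe (Lp.coeFn_sub ((2 * π : ℂ) • ofFun (eigPrim μ) (continuous_eigPrim hμ))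
      (constL2 (2 * π * eigPrim μ π))),
    ae_coe (Lp.coeFn_smul (2 * π : ℂ) (ofFun (eigPrim μ) (continuous_eigPrim hμ))),
    ae_coe (constL2_coeFn (2 * π * eigPrim μ π)), ae_restrict_mem measurableSet_Ioc]
    with y h1 h2 h3 h4 h5 hy
  rw [h1, h3, Pi.sub_apply, h4, Pi.smul_apply, h2, h5, smul_eq_mul]
  rcases le_total π y with h | h
  · rw [intervalIntegral_eigL2 hμ pi_pos.le h hy.2]
    ring
  · rw [intervalIntegral.integral_symm,
      intervalIntegral_eigL2 hμ hy.1.le h (by linarith [pi_pos])]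
    ring

/-- With G = `eigPrim μ` and f = dG/dt, differentiating t(1 - t) f = (1 + μ - 2t) G gives t(1 - t)
df/dt = μ f - 2G, and w d/dy = (π/2) t(1 - t) d/dt. The term -πG is what half of the primitive 2πG
cancels in A. -/
theorem isSpeedDeriv_eigL2 {μ : ℂ} (hμ : |μ.re| < 1 / 2) : IsSpeedDeriv (eigL2 hμ)
    ((π / 2 * μ : ℂ) • eigL2 hμ - (π : ℂ) • ofFun (eigPrim μ) (continuous_eigPrim hμ)) := by
  have hπ : (π : ℂ) ≠ 0 := by exact_mod_cast pi_ne_zero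
  rw [isSpeedDeriv_iff_coord]
  intro φ hφ _
  have cφ := hφ.continuous
  have cφ' := hφ.continuous_deriv (by simp)
  have cG := continuous_eigPrim hμ
  set v : L2 := (π / 2 * μ : ℂ) • eigL2 hμ - (π : ℂ) • ofFun (eigPrim μ) cG
  have i1 : IntervalIntegrable (fun y : ℝ => v (y : Circ) * φ y) volume 0 (2 * π) :=
    (v.intervalIntegrable _ _).mul_continuousOn cφ.continuousOn
  have i2 : IntervalIntegrable (fun y : ℝ => eigL2 hμ (y : Circ) * ((((π - y) / 2 : ℝ) : ℂ) * φ y +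
      ((y * (2 * π - y) / 4 : ℝ) : ℂ) * deriv φ y)) volume 0 (2 * π) :=
    ((eigL2 hμ).intervalIntegrable _ _).mul_continuousOn (by fun_prop)
  rw [eq_neg_iff_add_eq_zero, ← intervalIntegral.integral_add i1 i2]
  -- `D` is the derivative of w f φ, with w f written through `eigPrim μ` so that it is continuous
  -- up to the endpoints and vanishes there.
  set D : ℝ → ℂ := fun y => (π ^ 2 * (eigFun μ y / (2 * π)) * (1 + μ - y / π) +
    π ^ 2 * eigPrim μ y * (-(1 / π))) * φ y + π ^ 2 * eigPrim μ y * (1 + μ - y / π) * deriv φ y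
  have hae : ∀ᵐ y : ℝ ∂(volume.restrict (Set.uIoc 0 (2 * π))),
      v (y : Circ) * φ y + eigL2 hμ (y : Circ) * ((((π - y) / 2 : ℝ) : ℂ) * φ y +
        ((y * (2 * π - y) / 4 : ℝ) : ℂ) * deriv φ y) = D y := by
    rw [Set.uIoc_of_le Real.two_pi_pos.le]
    filter_upwards [ofFun_coe cG, eigL2_coe hμ, ae_mem_Ioo,
      ae_coe (Lp.coeFn_sub ((π / 2 * μ : ℂ) • eigL2 hμ) ((π : ℂ) • ofFun (eigPrim μ) cG)),
      ae_coe (Lp.coeFn_smul (π / 2 * μ : ℂ) (eigL2 hμ)),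
      ae_coe (Lp.coeFn_smul (π : ℂ) (ofFun (eigPrim μ) cG))] with y h1 h2 hy h3 h4 h5
    rw [h3, Pi.sub_apply, h4, h5, Pi.smul_apply, Pi.smul_apply, h1, h2, smul_eq_mul, smul_eq_mul]
    simp only [D]
    rw [← speed_mul_eigFun μ hy]
    push_cast
    field_simp
    ring
  rw [intervalIntegral.integral_congr_ae_restrict hae,
    intervalIntegral.integral_eq_sub_of_hasDerivAt_of_le
    (f := fun y : ℝ => π ^ 2 * eigPrim μ y * (1 + μ - y / π) * φ y) Real.two_pi_pos.le
    (by fun_prop) (fun y hy => ?_) ((i1.add i2).congr_ae hae)]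
  · simp [eigPrim_zero hμ, eigPrim_two_pi hμ]
  · have d1 : HasDerivAt (fun y : ℝ => (1 + μ - y / π : ℂ)) (-(1 / π)) y :=
      (((hasDerivAt_id (y : ℂ)).div_const (π : ℂ)).const_sub (1 + μ)).comp_ofReal
    exact (((hasDerivAt_eigPrim μ hy).const_mul ((π : ℂ) ^ 2)).mul d1).mul
      (hφ.differentiable (by simp) y).hasDerivAt

theorem mem_pointSpec_of_lt {z : ℂ} (hz : |z.re| < π / 4) : z ∈ pointSpec linOp := by
  have hπ : (π : ℂ) ≠ 0 := by exact_mod_cast pi_ne_zero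
  -- Chosen so that (π/2)μ = z; the open strip becomes |Re μ| < 1/2.
  set μ : ℂ := 2 / π * z with hμd
  have hzμ : (π / 2 * μ : ℂ) = z := by rw [hμd]; field_simp
  have hμ : |μ.re| < 1 / 2 := by
    have e : μ.re = 2 / π * z.re := by
      rw [hμd, ← Complex.re_ofReal_mul]; push_cast; rfl
    rw [e, abs_mul, abs_of_pos (by positivity : 0 < 2 / π), div_mul_eq_mul_div, div_lt_iff₀ pi_pos]
    linarith
  obtain ⟨F, hF, he⟩ := (isSpeedDeriv_eigL2 hμ).exists_linOp
  set G := ofFun (eigPrim μ) (continuous_eigPrim hμ)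
  obtain ⟨a, ha⟩ : ∃ a : ℂ, linOp F = z • (F : L2) + constL2 a := by
    have h1 : proj (primitive (proj (eigL2 hμ))) =
        (2 * π : ℂ) • G - (2 * π : ℂ) • (1 / (2 * π) : ℂ) • constL2 (circInt G) := by
      have h2 : ∀ a, proj (constL2 a) = 0 := fun a => by
        rw [proj_apply, circInt_const, ← map_smul, smul_eq_mul, ← map_sub]
        convert map_zero constL2 using 2
        field_simp
        ring
      rw [proj_of_circInt_eq_zero (circInt_eigL2 hμ), primitive_eigL2, map_sub, map_smul, h2,
        sub_zero, proj_apply, smul_sub]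
    refine ⟨-(1 / 2 * (2 * π * (1 / (2 * π) * circInt G))) - 1 / π * slopeInt (eigL2 hμ), ?_⟩
    rw [he, boundedPart_apply, h1, hzμ, hF]
    simp only [map_sub, map_neg, ← smul_eq_mul, map_smul]
    module
  -- Both A F and F have zero mean, so the constant has zero mean as well.
  have h0 : a = 0 := by
    have h1 := circInt_linOp F
    rw [ha, map_add, map_smul, hF, circInt_eigL2, circInt_const, smul_zero, zero_add] at h1
    exact (mul_eq_zero.1 h1).resolve_left (mul_ne_zero two_ne_zero hπ)
  refine ⟨F, fun h => eigL2_ne_zero hμ ?_, ?_⟩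
  · rw [← hF, h, ZeroMemClass.coe_zero]
  · rw [ha, h0, map_zero, add_zero]

/-- If z were in the closed strip, shrinking it towards 0 would give eigenvalues (1 - ε)z
arbitrarily close to z, which a bounded inverse forbids. -/
theorem lt_of_mem_resolventSet {z : ℂ} (hz : z ∈ resolventSet linOp) : π / 4 < |z.re| := by
  obtain ⟨R, -, hR⟩ := hz
  by_contra! hle
  have hd : 0 < ‖R‖ * ‖z‖ + 1 := by positivity
  -- This size makes ‖R‖ · ε‖z‖ < 1; the added 1 also covers z = 0.
  set ε : ℝ := (‖R‖ * ‖z‖ + 1)⁻¹ with hε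
  have hε0 : 0 < ε := inv_pos.2 hd
  have hε1 : ε ≤ 1 := inv_le_one_of_one_le₀
    (by linarith [mul_nonneg (norm_nonneg R) (norm_nonneg z)])
  have hlt : |(((1 - ε : ℝ) : ℂ) * z).re| < π / 4 := by
    rw [Complex.re_ofReal_mul, abs_mul, abs_of_nonneg (by linarith)]
    rcases (abs_nonneg z.re).eq_or_lt with h0 | h0
    · rw [← h0, mul_zero]
      positivity
    · nlinarith
  have h := one_le_of_mem_pointSpec hR (mem_pointSpec_of_lt hlt)
  have e : ((1 - ε : ℝ) : ℂ) * z - z = ((-ε : ℝ) : ℂ) * z := by push_cast; ring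
  rw [e, norm_mul, Complex.norm_real, norm_neg, Real.norm_of_nonneg hε0.le] at h
  have h2 : ε * (‖R‖ * ‖z‖ + 1) = 1 := inv_mul_cancel₀ hd.ne'
  nlinarith

theorem mem_resolventSet_iff {z : ℂ} : z ∈ resolventSet linOp ↔ π / 4 < |z.re| :=
  ⟨lt_of_mem_resolventSet, mem_resolventSet_of_lt⟩

end PeakedWave

end

/-! ### The spectrum, the point spectrum, the resolvent set and instability. -/

theorem mainTheorem2 :
    PeakedWave.spec PeakedWave.linOp = {z : ℂ | -(π / 4) ≤ z.re ∧ z.re ≤ π / 4} ∧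
    PeakedWave.pointSpec PeakedWave.linOp = {z : ℂ | -(π / 4) < z.re ∧ z.re < π / 4} ∧
    PeakedWave.resolventSet PeakedWave.linOp = {z : ℂ | π / 4 < |z.re|} ∧
    PeakedWave.SpectrallyUnstable PeakedWave.linOp := by
  have hs : PeakedWave.spec PeakedWave.linOp = {z : ℂ | -(π / 4) ≤ z.re ∧ z.re ≤ π / 4} := by
    ext z
    rw [PeakedWave.spec, Set.mem_compl_iff, PeakedWave.mem_resolventSet_iff, not_lt, abs_le]
    rfl
  refine ⟨hs, ?_, ?_, ?_⟩
  · ext z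
    exact ⟨fun h => abs_lt.1 (PeakedWave.abs_re_lt_of_mem_pointSpec h),
      fun h => PeakedWave.mem_pointSpec_of_lt (abs_lt.2 h)⟩
  · ext z
    exact PeakedWave.mem_resolventSet_iff
  · refine ⟨((π / 8 : ℝ) : ℂ), ?_, ?_⟩
    · rw [hs, Set.mem_ofPred_eq, Complex.ofReal_re]
      constructor <;> linarith [pi_pos]
    · rw [Complex.ofReal_re]
      positivity
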